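/- **Conventions.** An index of a computable Boolean algebra is a number $e$ such that the $e$-th partial computable function decides a set $D\subseteq\omega$ (the domain) and computes the operations $\vee,\wedge,\neg$ and the constants $0,1$ of a Boolean algebra with domain $D$. Write $e\cong_{comp} i$ if $e$ and $i$ are indices of computable Boolean algebras between which there is a computable isomorphism. For a linear order $L$ with least element, $\mathrm{Intalg}\,L$ is the subalgebra of the power set algebra $\mathcal P(L)$ generated by the intervals $[a,b)$ with $a\in L$, $b\in L\cup\{\infty\}$. Each of its elements has a unique expression $[a_1,b_1)\cup\dots\cup[a_n,b_n)$ with $a_1<b_1<a_2<\dots<a_n<b_n\le\infty$. If $L$ has a computable presentation with domain $\omega$, the canonical presentation of $\mathrm{Intalg}\,L$ represents this element by the code number of the sequence of its endpoints ($b_n$ being omitted if $b_n=\infty$). Sets $X,Y\subseteq\omega$ are 1-equivalent, $X\equiv_1Y$, if each is reducible to the other by a computable one-one function. **Theorem.** (i) Let $(V^e)_{e\in\omega}$ be a uniformly c.e. sequence of sets, each containing all even numbers (for instance an effective listing of all such c.e. sets). Let $L^e=\bigoplus_{x\in\omega}M^e_x$ be the ordered sum in which $M^e_x$ is $[0,1)_{\mathbb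 Q}$ if $x\in V^e$, and a single point if $x\notin V^e$. Then the orders $L^e$ have computable presentations with domain $\omega$, uniformly in $e$, in which $2x$ is the least element of $M^e_x$. They can be chosen so that the canonical presentations $C^e$ of $\mathrm{Intalg}\,L^e$ have an index $g(e)$ for some one-one computable function $g$, and for all $e,i$ $$V^e\equiv_1 V^i\iff C^e\text{ and }C^i\text{ are computably isomorphic}\iff g(e)\cong_{comp}g(i).$$ (ii) Computable isomorphism of computable Boolean algebras is complete for $\Sigma^0_3$ equivalence relations. That is, $\cong_{comp}$ is an equivalence relation on the set of indices of computable Boolean algebras, $\{\langle e,i\rangle: e\cong_{comp} i\}$ is $\Sigma^0_3$, and for each $\Sigma^0_3$ equivalence relation $S$ on $\omega$ there is a one-one computable function $g$, all of whose values are indices of computable Boolean algebras, such that $x\,S\,y\iff g(x)\cong_{comp} g(y)$ for all $x,y$. -/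

import Mathlib

open scoped symmDiff

/-! ## Computability on the natural numbers -/

/-- The partial computable function with index `e`, in the standard numbering of codes. -/
def phi (e : ℕ) : ℕ →. ℕ := (Denumerable.ofNat Nat.Partrec.Code e).eval

/-- A binary relation on `ℕ` is `Σ⁰₃` if it has the form `∃ a ∀ b ∃ c, P` with `P` computable. -/
def IsSigmaThree (R : ℕ → ℕ → Prop) : Prop :=
  ∃ P : ℕ × ℕ × ℕ × ℕ × ℕ → Prop, ComputablePred P ∧
    ∀ x y, R x y ↔ ∃ a, ∀ b, ∃ c, P (x, y, a, b, c)

/-- `E` is an equivalence relation on the set `D` of natural numbers (and relates only members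
of `D`), it is `Σ⁰₃` as a set of pairs, and each `Σ⁰₃` equivalence relation `S` on `ℕ` is reducible
to it by an injective computable function `g` with values in `D`. -/
structure IsSigmaThreeEqComplete (D : Set ℕ) (E : ℕ → ℕ → Prop) : Prop where
  mem_left : ∀ e i, E e i → e ∈ D
  mem_right : ∀ e i, E e i → i ∈ D
  refl : ∀ e ∈ D, E e e
  symm : ∀ e i, E e i → E i e
  trans : ∀ e i j, E e i → E i j → E e j
  sigmaThree : IsSigmaThree E
  complete : ∀ S : ℕ → ℕ → Prop, Equivalence S → IsSigmaThree S →
    ∃ g : ℕ → ℕ, Computable g ∧ Function.Injective g ∧ (∀ x, g x ∈ D) ∧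
      ∀ x y, S x y ↔ E (g x) (g y)

/-! ## Computable Boolean algebras -/

/-- A Boolean algebra whose elements are named by distinct natural numbers. It stands for the
Boolean algebra with domain `Set.range code ⊆ ℕ` that is obtained by transport along `code`. -/
structure CodedBA where
  Carrier : Type
  [str : BooleanAlgebra Carrier]
  code : Carrier → ℕ
  code_injective : Function.Injective code

attribute [instance] CodedBA.str

/-- `e` is an index of the Boolean algebra `B` as a computable structure: `phi e` decides the
domain and computes the operations. -/
structure CodedBA.HasIndex (B : CodedBA) (e : ℕ) : Prop where
  mem_dom : ∀ n, n ∈ Set.range B.code → phi e (Nat.pair 0 n) = Part.some 1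
  not_mem_dom : ∀ n, n ∉ Set.range B.code → phi e (Nat.pair 0 n) = Part.some 0
  sup : ∀ x y : B.Carrier,
    phi e (Nat.pair 1 (Nat.pair (B.code x) (B.code y))) = Part.some (B.code (x ⊔ y))
  inf : ∀ x y : B.Carrier,
    phi e (Nat.pair 2 (Nat.pair (B.code x) (B.code y))) = Part.some (B.code (x ⊓ y))
  compl : ∀ x : B.Carrier, phi e (Nat.pair 3 (B.code x)) = Part.some (B.code xᶜ)
  bot : phi e (Nat.pair 4 0) = Part.some (B.code ⊥)
  top : phi e (Nat.pair 5 0) = Part.some (B.code ⊤)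

/-- There is an isomorphism of the Boolean algebras `A` and `B` that is the restriction to the
domain of `A` of a partial computable function. (If `A` and `B` are computable, so that their
domains are computable sets, then the inverse is automatically computable too.) -/
def CodedBA.CompIso (A B : CodedBA) : Prop :=
  ∃ (f : A.Carrier ≃o B.Carrier) (p : ℕ →. ℕ), Nat.Partrec p ∧
    ∀ x : A.Carrier, p (A.code x) = Part.some (B.code (f x))

/-- The set of indices of computable Boolean algebras. -/
def computableBAIndices : Set ℕ := {e | ∃ B : CodedBA, B.HasIndex e}

/-- Computable isomorphism of computable Boolean algebras, as a relation on indices. -/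
def compIsoBA (e i : ℕ) : Prop :=
  ∃ A B : CodedBA, A.HasIndex e ∧ B.HasIndex i ∧ A.CompIso B

/-! ## Interval algebras -/

section IntervalAlgebra

variable {L : Type} [LinearOrder L]

/-- The subalgebra of the power set of `L` generated by the intervals `[a, b)` with `a ∈ L` and
`b ∈ L ∪ {∞}`. -/
def intalg (L : Type) [LinearOrder L] : BooleanSubalgebra (Set L) :=
  BooleanSubalgebra.closure ({S | ∃ a b, S = Set.Ico a b} ∪ {S | ∃ a, S = Set.Ici a})

/-- The union `[a₁, b₁) ∪ ⋯ ∪ [aₙ, bₙ)` for the list of endpoints `a₁, b₁, …, aₙ, bₙ`. A list of odd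
length stands for the case `bₙ = ∞`. -/
def unionIco : List L → Set L
  | [] => ∅
  | [a] => Set.Ici a
  | a :: b :: l => Set.Ico a b ∪ unionIco l

theorem mem_unionIco_iff (x : L) : ∀ l : List L, l.Pairwise (· < ·) →
    (x ∈ unionIco l ↔ Odd (l.countP (fun a => decide (a ≤ x))))
  | [], _ => by simp [unionIco]
  | [a], _ => by
      by_cases h : a ≤ x <;> simp [unionIco, h]
  | a :: b :: l, h => by
      rw [List.pairwise_cons, List.pairwise_cons] at h
      obtain ⟨h1, h2, h3⟩ := h
      have ih := mem_unionIco_iff x l h3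
      have hab : a < b := h1 b (by simp)
      simp only [unionIco, Set.mem_union, Set.mem_Ico, ih, List.countP_cons, decide_eq_true_eq]
      by_cases hb : b ≤ x
      · have ha : a ≤ x := hab.le.trans hb
        simp only [hb, ha, if_true, not_lt.mpr hb, and_false, false_or]
        rw [add_assoc, Nat.odd_add]
        simp
      · have h0 : l.countP (fun c => decide (c ≤ x)) = 0 := by
          rw [List.countP_eq_zero]
          intro c hc
          simpa using (not_le.mp hb).trans (h2 c hc)
        rw [h0]
        by_cases ha : a ≤ x
        · simp [hb, ha, not_le.mp hb]
        · simp [hb, ha]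

/-- The set of points with an odd number of elements of `F` below or equal to them. -/
def paritySet (F : Finset L) : Set L := {x | Odd (F.filter (· ≤ x)).card}

theorem unionIco_sort (F : Finset L) : unionIco (F.sort (· ≤ ·)) = paritySet F := by
  ext x
  have hs : (F.sort (· ≤ ·)).Pairwise (· < ·) := F.sortedLT_sort.pairwise
  rw [mem_unionIco_iff x _ hs]
  have : (F.sort (· ≤ ·)).countP (fun a => decide (a ≤ x)) = (F.filter (· ≤ x)).card := by
    rw [← Multiset.coe_countP, Finset.sort_eq, Multiset.countP_eq_card_filter]
    simp [Finset.card_def, Finset.filter_val]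
  rw [this]; rfl

theorem paritySet_insert {a : L} {F : Finset L} (h : a ∉ F) :
    paritySet (insert a F) = Set.Ici a ∆ paritySet F := by
  ext x
  simp only [paritySet, Set.mem_symmDiff, Set.mem_ofPred_eq, Set.mem_Ici, Finset.filter_insert]
  by_cases ha : a ≤ x
  · rw [if_pos ha, Finset.card_insert_of_notMem (by simp [h])]
    simp [ha, Nat.odd_add_one]
  · simp [ha]

theorem exists_paritySet_Ici (a : L) (F : Finset L) :
    ∃ G, paritySet G = Set.Ici a ∆ paritySet F := by
  by_cases h : a ∈ F
  · refine ⟨F.erase a, ?_⟩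
    conv_rhs => rw [← Finset.insert_erase h, paritySet_insert (Finset.notMem_erase a F)]
    simp
  · exact ⟨insert a F, paritySet_insert h⟩

theorem paritySet_empty : paritySet (∅ : Finset L) = ∅ := by
  ext x; simp [paritySet]

theorem exists_paritySet_symmDiff (F G : Finset L) :
    ∃ H, paritySet H = paritySet F ∆ paritySet G := by
  induction F using Finset.induction_on with
  | empty => exact ⟨G, by simp [paritySet_empty, ← Set.bot_eq_empty]⟩
  | insert a F ha ih =>
    obtain ⟨H, hH⟩ := ih
    obtain ⟨K, hK⟩ := exists_paritySet_Ici a H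
    exact ⟨K, by rw [hK, hH, paritySet_insert ha, symmDiff_assoc]⟩

theorem exists_paritySet_Ici_inter (a : L) (G : Finset L) :
    ∃ H, paritySet H = Set.Ici a ∩ paritySet G := by
  induction G using Finset.induction_on with
  | empty => exact ⟨∅, by simp [paritySet_empty]⟩
  | insert b G hb ih =>
    obtain ⟨H, hH⟩ := ih
    obtain ⟨K, hK⟩ := exists_paritySet_Ici (a ⊔ b) H
    refine ⟨K, ?_⟩
    rw [hK, hH, paritySet_insert hb, Set.inter_symmDiff_distrib_left, Set.Ici_inter_Ici]

theorem exists_paritySet_inter (F G : Finset L) :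
    ∃ H, paritySet H = paritySet F ∩ paritySet G := by
  induction F using Finset.induction_on with
  | empty => exact ⟨∅, by simp [paritySet_empty]⟩
  | insert a F ha ih =>
    obtain ⟨H, hH⟩ := ih
    obtain ⟨J, hJ⟩ := exists_paritySet_Ici_inter a G
    obtain ⟨K, hK⟩ := exists_paritySet_symmDiff J H
    exact ⟨K, by rw [hK, hH, hJ, paritySet_insert ha, Set.inter_symmDiff_distrib_right]⟩

theorem paritySet_singleton (a : L) : paritySet {a} = Set.Ici a := by
  rw [← insert_empty_eq, paritySet_insert (Finset.notMem_empty a), paritySet_empty,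
    ← Set.bot_eq_empty, symmDiff_bot]

theorem exists_paritySet_compl [OrderBot L] (F : Finset L) :
    ∃ H, paritySet H = (paritySet F)ᶜ := by
  obtain ⟨H, hH⟩ := exists_paritySet_Ici (⊥ : L) F
  exact ⟨H, by rw [hH, Set.Ici_bot, ← Set.top_eq_univ, top_symmDiff, hnot_eq_compl]⟩

/-- Each element of the interval algebra of a linear order with least element has the form
`[a₁, b₁) ∪ ⋯ ∪ [aₙ, bₙ)` where `a₁ < b₁ < ⋯ < aₙ < bₙ ≤ ∞`. -/
theorem exists_unionIco_eq [OrderBot L] {S : Set L} (hS : S ∈ intalg L) :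
    ∃ l : List L, l.Pairwise (· < ·) ∧ unionIco l = S := by
  suffices h : ∃ F, paritySet F = S by
    obtain ⟨F, rfl⟩ := h
    exact ⟨_, F.sortedLT_sort.pairwise, unionIco_sort F⟩
  unfold intalg at hS
  induction hS using BooleanSubalgebra.closure_bot_sup_induction with
  | mem S hS =>
    rcases hS with ⟨a, b, rfl⟩ | ⟨a, rfl⟩
    · obtain ⟨H, hH⟩ := exists_paritySet_compl ({b} : Finset L)
      obtain ⟨K, hK⟩ := exists_paritySet_inter {a} H
      refine ⟨K, ?_⟩
      rw [hK, hH, paritySet_singleton, paritySet_singleton, Set.compl_Ici, Set.Ici_inter_Iio]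
    · exact ⟨{a}, paritySet_singleton a⟩
  | bot => exact ⟨∅, paritySet_empty⟩
  | sup S _ T _ hS hT =>
    obtain ⟨F, rfl⟩ := hS
    obtain ⟨G, rfl⟩ := hT
    obtain ⟨F', hF⟩ := exists_paritySet_compl F
    obtain ⟨G', hG⟩ := exists_paritySet_compl G
    obtain ⟨H, hH⟩ := exists_paritySet_inter F' G'
    obtain ⟨K, hK⟩ := exists_paritySet_compl H
    refine ⟨K, ?_⟩
    rw [hK, hH, hF, hG, Set.compl_inter, compl_compl, compl_compl]
    rfl
  | compl S _ hS =>
    obtain ⟨F, rfl⟩ := hS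
    exact exists_paritySet_compl F

/-- The increasing list of endpoints `a₁ < b₁ < ⋯ < aₙ < bₙ ≤ ∞` of an element of the interval
algebra, with `bₙ` left out if it is `∞`. -/
noncomputable def endpoints [OrderBot L] (S : intalg L) : List L :=
  (exists_unionIco_eq S.2).choose

theorem endpoints_pairwise [OrderBot L] (S : intalg L) : (endpoints S).Pairwise (· < ·) :=
  (exists_unionIco_eq S.2).choose_spec.1

theorem unionIco_endpoints [OrderBot L] (S : intalg L) : unionIco (endpoints S) = S :=
  (exists_unionIco_eq S.2).choose_spec.2

theorem unionIco_cons (a : L) (l : List L) (h : (a :: l).Pairwise (· < ·)) :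
    unionIco l = Set.Ici a \ unionIco (a :: l) := by
  ext x
  have hl := (List.pairwise_cons.mp h).2
  rw [Set.mem_sdiff, mem_unionIco_iff x _ h, mem_unionIco_iff x _ hl, List.countP_cons]
  by_cases ha : a ≤ x
  · simp [ha, Nat.odd_add_one]
  · have h0 : l.countP (fun c => decide (c ≤ x)) = 0 := by
      rw [List.countP_eq_zero]
      intro c hc
      simpa using (not_le.mp ha).trans ((List.pairwise_cons.mp h).1 c hc)
    simp [ha, h0]

theorem isLeast_unionIco (a : L) (l : List L) (h : (a :: l).Pairwise (· < ·)) :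
    IsLeast (unionIco (a :: l)) a := by
  have hh := List.pairwise_cons.mp h
  have h0 : ∀ x ≤ a, l.countP (fun c => decide (c ≤ x)) = 0 := by
    intro x hx
    rw [List.countP_eq_zero]
    intro c hc
    simpa using hx.trans_lt (hh.1 c hc)
  constructor
  · rw [mem_unionIco_iff a _ h, List.countP_cons, h0 a le_rfl]
    simp
  · intro x hx
    by_contra hc
    rw [mem_unionIco_iff x _ h, List.countP_cons, h0 x (not_le.mp hc).le] at hx
    simp [hc] at hx

/-- The increasing list of endpoints is determined by the set. -/
theorem unionIco_inj : ∀ l m : List L, l.Pairwise (· < ·) → m.Pairwise (· < ·) →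
    unionIco l = unionIco m → l = m
  | [], [], _, _, _ => rfl
  | [], b :: m, _, hm, h => by
      have := (isLeast_unionIco b m hm).1
      rw [← h] at this
      exact this.elim
  | a :: l, [], hl, _, h => by
      have := (isLeast_unionIco a l hl).1
      rw [h] at this
      exact this.elim
  | a :: l, b :: m, hl, hm, h => by
      have hab : a = b := by
        have h1 := isLeast_unionIco a l hl
        rw [h] at h1
        exact h1.unique (isLeast_unionIco b m hm)
      subst hab
      have h2 : unionIco l = unionIco m := by
        rw [unionIco_cons a l hl, unionIco_cons a m hm, h]
      rw [unionIco_inj l m (List.pairwise_cons.mp hl).2 (List.pairwise_cons.mp hm).2 h2]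

/-- The canonical presentation of the interval algebra of `L` that comes from a naming `c` of the
elements of `L` by natural numbers: an element of the algebra is named by the sequence of the names
of its endpoints. -/
noncomputable def intalgBA (L : Type) [LinearOrder L] [OrderBot L] (c : L ↪ ℕ) : CodedBA where
  Carrier := intalg L
  code S := Encodable.encode ((endpoints S).map c)
  code_injective S T h := by
    have h1 := List.map_injective_iff.mpr c.injective (Encodable.encode_injective h)
    exact Subtype.ext (by rw [← unionIco_endpoints S, ← unionIco_endpoints T, h1])

end IntervalAlgebra

/-! ## The linear orders -/

/-- The summand for the point `x`: the order `[0,1)_ℚ` if `x ∈ V`, and a single point if not. -/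
def Block (V : Set ℕ) (x : ℕ) : Type := {q : ℚ // 0 ≤ q ∧ q < 1 ∧ (q = 0 ∨ x ∈ V)}

noncomputable instance (V : Set ℕ) (x : ℕ) : LinearOrder (Block V x) :=
  inferInstanceAs (LinearOrder {q : ℚ // 0 ≤ q ∧ q < 1 ∧ (q = 0 ∨ x ∈ V)})

instance (V : Set ℕ) (x : ℕ) : OrderBot (Block V x) where
  bot := ⟨0, le_rfl, zero_lt_one, Or.inl rfl⟩
  bot_le q := q.2.1

/-- The ordered sum over `x ∈ ω` of the blocks: the order obtained from `ω` when each element of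
`V` is replaced by a copy of `[0,1)_ℚ`. -/
abbrev Expansion (V : Set ℕ) : Type := Σₗ x : ℕ, Block V x

/-- The least element of the block of `x` in the ordered sum. -/
def Expansion.min (V : Set ℕ) (x : ℕ) : Expansion V := toLex ⟨x, ⊥⟩

/-!
The proof has two independent halves.

**Coding a c.e. set into an interval algebra.** For an order `Expansion (V e)`, the block of `x`
is an element `B_x` of the interval algebra, whose code can be computed from `x`. A dense block
has no isolated points, so the atoms are exactly the blocks `B_x` with `x ∉ V e`
(`Expansion.isAtom_iff`), and these `x` are odd. Given a computable isomorphism `f`, map `x` to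
`y` if `f B_x = B_y` with `y` odd, and to `2x` otherwise: this is a one-one reduction of `V e` to
`V i` (`Presentation.oneOneReducible_of_compIso`). Conversely, by Myhill's theorem
(`OneOneEquiv.exists_equiv`) one-one equivalence yields a computable permutation `p` of `ω` that
maps `V e` onto `V i`. The map `(x, q) ↦ (p x, q)` is not monotone, but the image of each final
segment `[z, ∞)` is again a finite union of intervals, since only finitely many blocks precede
`z`; so it induces an isomorphism of the interval algebras (`Expansion.intalgIso`), which is
computable. Elements of interval algebras are handled as arbitrary finite lists of endpoints, a
point belonging to the set if an odd number of entries are below or equal to it (`oddSet`); the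
canonical list is recovered by sorting and cancelling pairs (`oddSort`).

**Reducing a `Σ⁰₃` equivalence relation to one-one equivalence.** Let `S x y` mean that for some
`a` the `Π⁰₂` condition number `k = ⟨x, y, a⟩` is true. C.e. sets `A_z` are built by an infinite
injury construction on the tree of guesses about which of the conditions are true. A node `σ`
identifies the indices `x`, `y` of the conditions that it guesses to be true, and puts its
witnesses into the sets of a whole class of identified indices. If `S x y` holds because of
condition `k`, then the nodes that extend the first `k + 1` correct guesses treat `A_x` and `A_y`
alike, and outside this cone both sets are decidable (`Guessing.computablePred_inLimit_off_cone`),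
so that `A_x` and `A_y` are many-one equivalent. If `S x y` fails, no node on the true path
identifies `x` and `y`, and the node with number `⟨x, y, e⟩` makes sure that the `e`-th function
is not a many-one reduction of `A_x` to `A_y` (`Guessing.not_manyOneReducible`). Padding turns
many-one equivalence into one-one equivalence of sets that contain the even numbers
(`IsSigmaThree.exists_oneOneEquiv`).

The relation `compIsoBA` itself is `Σ⁰₃`, since it says that there is a number `a` such that all
instances of certain c.e. conditions hold: the two indices satisfy the equational axioms of
Boolean algebras, and the `a`-th partial computable function is an isomorphism
(`compIsoBA_iff_exists`).
-/

/-! ### Closure properties of computable functions and predicates -/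

-- With these tags, `fun_prop` derives the computability of a function or predicate from the way
-- in which it is put together.
attribute [fun_prop] Computable ComputablePred REPred
attribute [fun_prop] Computable.id Computable.const Computable.comp Computable.pair

section ComputableTools

variable {α β γ σ : Type*} [Primcodable α] [Primcodable β] [Primcodable γ] [Primcodable σ]

namespace Computable

@[fun_prop]
theorem fst_comp {f : α → β × γ} (hf : Computable f) : Computable fun a => (f a).1 :=
  Computable.fst.comp hf

@[fun_prop]
theorem snd_comp {f : α → β × γ} (hf : Computable f) : Computable fun a => (f a).2 :=
  Computable.snd.comp hf

@[fun_prop]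
theorem add_comp {f g : α → ℕ} (hf : Computable f) (hg : Computable g) :
    Computable fun a => f a + g a := Primrec.nat_add.to_comp.comp hf hg

@[fun_prop]
theorem sub_comp {f g : α → ℕ} (hf : Computable f) (hg : Computable g) :
    Computable fun a => f a - g a := Primrec.nat_sub.to_comp.comp hf hg

@[fun_prop]
theorem mul_comp {f g : α → ℕ} (hf : Computable f) (hg : Computable g) :
    Computable fun a => f a * g a := Primrec.nat_mul.to_comp.comp hf hg

@[fun_prop]
theorem div_comp {f g : α → ℕ} (hf : Computable f) (hg : Computable g) :
    Computable fun a => f a / g a := Primrec.nat_div.to_comp.comp hf hg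

@[fun_prop]
theorem mod_comp {f g : α → ℕ} (hf : Computable f) (hg : Computable g) :
    Computable fun a => f a % g a := Primrec.nat_mod.to_comp.comp hf hg

@[fun_prop]
theorem natPair_comp {f g : α → ℕ} (hf : Computable f) (hg : Computable g) :
    Computable fun a => Nat.pair (f a) (g a) := Primrec₂.natPair.to_comp.comp hf hg

@[fun_prop]
theorem unpair_comp {f : α → ℕ} (hf : Computable f) : Computable fun a => (f a).unpair :=
  Computable.unpair.comp hf

@[fun_prop]
theorem encode_comp {f : α → β} (hf : Computable f) :
    Computable fun a => Encodable.encode (f a) := Computable.encode.comp hf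

@[fun_prop]
theorem decode_comp {f : α → ℕ} (hf : Computable f) :
    Computable fun a => (Encodable.decode (f a) : Option β) := Computable.decode.comp hf

@[fun_prop]
theorem ofNat_comp {δ : Type*} [Denumerable δ] {f : α → ℕ} (hf : Computable f) :
    Computable fun a => Denumerable.ofNat δ (f a) := (Computable.ofNat δ).comp hf

@[fun_prop]
theorem some_comp {f : α → β} (hf : Computable f) : Computable fun a => some (f a) :=
  Computable.option_some.comp hf

@[fun_prop]
theorem cons_comp {f : α → β} {g : α → List β} (hf : Computable f) (hg : Computable g) :
    Computable fun a => f a :: g a := Computable.list_cons.comp hf hg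

@[fun_prop]
theorem append_comp {f g : α → List β} (hf : Computable f) (hg : Computable g) :
    Computable fun a => f a ++ g a := Computable.list_append.comp hf hg

@[fun_prop]
theorem length_comp {f : α → List β} (hf : Computable f) : Computable fun a => (f a).length :=
  Computable.list_length.comp hf

@[fun_prop]
theorem take_comp {f : α → ℕ} {g : α → List β} (hf : Computable f) (hg : Computable g) :
    Computable fun a => (g a).take (f a) := Primrec.list_take.to_comp.comp hf hg

@[fun_prop]
theorem range_comp {f : α → ℕ} (hf : Computable f) : Computable fun a => List.range (f a) :=
  Primrec.list_range.to_comp.comp hf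

@[fun_prop]
theorem getElem?_comp {f : α → List β} {g : α → ℕ} (hf : Computable f) (hg : Computable g) :
    Computable fun a => (f a)[g a]? := Computable.list_getElem?.comp hf hg

@[fun_prop]
theorem toList_comp {f : α → Option β} (hf : Computable f) : Computable fun a => (f a).toList :=
  Primrec.optionToList.to_comp.comp hf

@[fun_prop]
theorem getD_comp {f : α → Option β} {g : α → β} (hf : Computable f) (hg : Computable g) :
    Computable fun a => (f a).getD (g a) := Computable.option_getD hf hg

@[fun_prop]
theorem bind_comp {f : α → Option β} {g : α → β → Option σ} (hf : Computable f)
    (hg : Computable fun x : α × β => g x.1 x.2) : Computable fun a => (f a).bind (g a) :=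
  Computable.option_bind hf hg

@[fun_prop]
theorem ite_comp {c : α → Prop} [DecidablePred c] {f g : α → σ} (hc : ComputablePred c)
    (hf : Computable f) (hg : Computable g) : Computable fun a => if c a then f a else g a := by
  simpa [Bool.cond_decide] using Computable.cond hc.decide hf hg

@[fun_prop]
theorem decide_comp {c : α → Prop} [DecidablePred c] (hc : ComputablePred c) :
    Computable fun a => decide (c a) := hc.decide

@[fun_prop]
theorem nat_rec_comp {n : α → ℕ} {g : α → σ} {h : α → ℕ → σ → σ} (hn : Computable n)
    (hg : Computable g) (hh : Computable fun x : α × ℕ × σ => h x.1 x.2.1 x.2.2) :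
    Computable fun a => Nat.rec (motive := fun _ => σ) (g a) (h a) (n a) :=
  Computable.nat_rec hn hg hh.to₂

@[fun_prop]
theorem evaln_comp {s n : α → ℕ} {c : α → Nat.Partrec.Code} (hs : Computable s)
    (hc : Computable c) (hn : Computable n) :
    Computable fun a => Nat.Partrec.Code.evaln (s a) (c a) (n a) :=
  (Nat.Partrec.Code.primrec_evaln.to_comp).comp ((hs.pair hc).pair hn)

theorem foldr_comp {l : α → List β} {b : α → σ} {h : α → β → σ → σ} (hl : Computable l)
    (hb : Computable b) (hh : Computable fun x : α × β × σ => h x.1 x.2.1 x.2.2) :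
    Computable fun a => (l a).foldr (h a) (b a) := by
  have hstep : Computable fun x : (α × ℕ × σ) =>
      (((l x.1)[(l x.1).length - 1 - x.2.1]?).bind
        fun y => some (h x.1 y x.2.2)).getD x.2.2 := by
    have : Computable fun z : (α × ℕ × σ) × β => h z.1.1 z.2 z.1.2.2 :=
      hh.comp (f := fun x : α × β × σ => h x.1 x.2.1 x.2.2)
        (g := fun z : (α × ℕ × σ) × β => (z.1.1, z.2, z.1.2.2)) (by fun_prop)
    fun_prop
  have key : Computable fun a => Nat.rec (motive := fun _ => σ) (b a)
      (fun n s => (((l a)[(l a).length - 1 - n]?).bind fun y => some (h a y s)).getD s)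
      (l a).length := nat_rec_comp (by fun_prop) hb hstep
  refine key.of_eq fun a => ?_
  -- after `n` steps of the recursion the last `n` entries of the list have been processed
  have : ∀ n ≤ (l a).length, Nat.rec (motive := fun _ => σ) (b a)
      (fun n s => (((l a)[(l a).length - 1 - n]?).bind fun y => some (h a y s)).getD s) n
      = ((l a).drop ((l a).length - n)).foldr (h a) (b a) := by
    intro n hn
    induction n with
    | zero => simp
    | succ n ih =>
      have hlt : (l a).length - 1 - n < (l a).length := by omega
      have e : (l a).length - (n + 1) = (l a).length - 1 - n := by omega
      have e2 : (l a).length - n = (l a).length - 1 - n + 1 := by omega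
      simp only [ih (by omega)]
      rw [List.getElem?_eq_getElem hlt, e, e2]
      conv_rhs => rw [List.drop_eq_getElem_cons hlt, List.foldr_cons]
      rfl
  rw [this _ le_rfl]
  simp

end Computable

namespace ComputablePred

@[fun_prop]
theorem comp_computable {p : β → Prop} {f : α → β} (hp : ComputablePred p) (hf : Computable f) :
    ComputablePred fun a => p (f a) := by
  obtain ⟨g, hg, rfl⟩ := computable_iff.1 hp
  exact computable_iff.2 ⟨fun a => g (f a), hg.comp hf, rfl⟩

@[fun_prop]
theorem of_bool {f : α → Bool} (hf : Computable f) : ComputablePred fun a => f a = true :=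
  computable_iff.2 ⟨f, hf, rfl⟩

@[fun_prop]
theorem const_prop (p : Prop) : ComputablePred fun _ : α => p := by
  by_cases h : p
  · exact (of_bool (Computable.const true)).of_eq fun _ => by simp [h]
  · exact (of_bool (Computable.const false)).of_eq fun _ => by simp [h]

@[fun_prop]
theorem not_comp {p : α → Prop} (hp : ComputablePred p) : ComputablePred fun a => ¬p a := hp.not

@[fun_prop]
theorem and_comp {p q : α → Prop} (hp : ComputablePred p) (hq : ComputablePred q) :
    ComputablePred fun a => p a ∧ q a := by
  obtain ⟨f, hf, rfl⟩ := computable_iff.1 hp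
  obtain ⟨g, hg, rfl⟩ := computable_iff.1 hq
  exact computable_iff.2 ⟨fun a => f a && g a, Primrec.and.to_comp.comp hf hg, by simp⟩

@[fun_prop]
theorem or_comp {p q : α → Prop} (hp : ComputablePred p) (hq : ComputablePred q) :
    ComputablePred fun a => p a ∨ q a :=
  ((hp.not.and_comp hq.not).not).of_eq fun a => by tauto

@[fun_prop]
theorem imp_comp {p q : α → Prop} (hp : ComputablePred p) (hq : ComputablePred q) :
    ComputablePred fun a => p a → q a :=
  (hp.not.or_comp hq).of_eq fun a => by tauto

@[fun_prop]
theorem eq_comp {f g : α → β} (hf : Computable f) (hg : Computable g) :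
    ComputablePred fun a => f a = g a :=
  (comp_computable (PrimrecPred.computablePred Primrec.eq) (hf.pair hg))

@[fun_prop]
theorem ne_comp {f g : α → β} (hf : Computable f) (hg : Computable g) :
    ComputablePred fun a => f a ≠ g a := (eq_comp hf hg).not

@[fun_prop]
theorem lt_comp {f g : α → ℕ} (hf : Computable f) (hg : Computable g) :
    ComputablePred fun a => f a < g a :=
  (comp_computable (PrimrecPred.computablePred Primrec.nat_lt) (hf.pair hg))

@[fun_prop]
theorem le_comp {f g : α → ℕ} (hf : Computable f) (hg : Computable g) :
    ComputablePred fun a => f a ≤ g a :=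
  (comp_computable (PrimrecPred.computablePred Primrec.nat_le) (hf.pair hg))

@[fun_prop]
theorem forall_mem_comp {l : α → List β} {p : α → β → Prop} (hl : Computable l)
    (hp : ComputablePred fun x : α × β => p x.1 x.2) :
    ComputablePred fun a => ∀ x ∈ l a, p a x := by
  classical
  have hd : Computable fun x : α × β => decide (p x.1 x.2) := hp.decide
  have h : Computable fun a => (l a).foldr (fun x b => decide (p a x) && b) true :=
    Computable.foldr_comp (h := fun a x b => decide (p a x) && b) hl (by fun_prop)
      (Primrec.and.to_comp.comp (hd.comp (g := fun x : α × β × Bool => (x.1, x.2.1)) (by fun_prop))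
        (by fun_prop))
  refine (of_bool h).of_eq fun a => ?_
  induction l a with
  | nil => simp
  | cons x l ih => simp_all

@[fun_prop]
theorem exists_mem_comp {l : α → List β} {p : α → β → Prop} (hl : Computable l)
    (hp : ComputablePred fun x : α × β => p x.1 x.2) :
    ComputablePred fun a => ∃ x ∈ l a, p a x :=
  (forall_mem_comp (p := fun a x => ¬p a x) hl hp.not).not.of_eq fun a => by simp

@[fun_prop]
theorem forall_lt_comp {f : α → ℕ} {p : α → ℕ → Prop} (hf : Computable f)
    (hp : ComputablePred fun x : α × ℕ => p x.1 x.2) :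
    ComputablePred fun a => ∀ x < f a, p a x :=
  (forall_mem_comp (l := fun a => List.range (f a)) (by fun_prop) hp).of_eq fun a => by simp

@[fun_prop]
theorem exists_lt_comp {f : α → ℕ} {p : α → ℕ → Prop} (hf : Computable f)
    (hp : ComputablePred fun x : α × ℕ => p x.1 x.2) :
    ComputablePred fun a => ∃ x < f a, p a x :=
  (forall_lt_comp (p := fun a x => ¬p a x) hf hp.not).not.of_eq fun a => by simp

@[fun_prop]
theorem forall_le_comp {f : α → ℕ} {p : α → ℕ → Prop} (hf : Computable f)
    (hp : ComputablePred fun x : α × ℕ => p x.1 x.2) :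
    ComputablePred fun a => ∀ x ≤ f a, p a x :=
  (forall_lt_comp (f := fun a => f a + 1) (by fun_prop) hp).of_eq fun a => by simp

@[fun_prop]
theorem exists_le_comp {f : α → ℕ} {p : α → ℕ → Prop} (hf : Computable f)
    (hp : ComputablePred fun x : α × ℕ => p x.1 x.2) :
    ComputablePred fun a => ∃ x ≤ f a, p a x :=
  (exists_lt_comp (f := fun a => f a + 1) (by fun_prop) hp).of_eq fun a => by simp

@[fun_prop]
theorem prefix_comp {f g : α → List β} (hf : Computable f) (hg : Computable g) :
    ComputablePred fun a => f a <+: g a := by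
  simp only [List.prefix_iff_eq_take]; fun_prop

theorem mem_finite {F : Set α} (hF : F.Finite) : ComputablePred fun a => a ∈ F := by
  have : ComputablePred fun a => ∃ x ∈ hF.toFinset.toList, a = x := by fun_prop
  exact this.of_eq fun a => by simp

end ComputablePred

namespace Computable

@[fun_prop]
theorem map_comp {l : α → List β} {f : α → β → σ} (hl : Computable l)
    (hf : Computable fun x : α × β => f x.1 x.2) : Computable fun a => (l a).map (f a) := by
  have h1 : Computable fun x : α × β × List σ => f x.1 x.2.1 :=
    hf.comp (g := fun x : α × β × List σ => (x.1, x.2.1)) (by fun_prop)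
  refine (foldr_comp (h := fun a x acc => f a x :: acc) hl (Computable.const []) ?_).of_eq ?_
  · fun_prop
  · intro a
    induction l a with
    | nil => rfl
    | cons x l ih => simp_all

@[fun_prop]
theorem filter_comp {l : α → List β} {p : α → β → Bool} (hl : Computable l)
    (hp : Computable fun x : α × β => p x.1 x.2) : Computable fun a => (l a).filter (p a) := by
  have h1 : Computable fun x : α × β × List β => p x.1 x.2.1 :=
    hp.comp (g := fun x : α × β × List β => (x.1, x.2.1)) (by fun_prop)
  refine (foldr_comp (h := fun a x acc => if p a x = true then x :: acc else acc) hl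
    (Computable.const []) ?_).of_eq ?_
  · fun_prop
  · intro a
    induction l a with
    | nil => rfl
    | cons x l ih => simp [List.filter_cons, ih]

@[fun_prop]
theorem flatMap_comp {l : α → List β} {f : α → β → List σ} (hl : Computable l)
    (hf : Computable fun x : α × β => f x.1 x.2) : Computable fun a => (l a).flatMap (f a) := by
  have h1 : Computable fun x : α × β × List σ => f x.1 x.2.1 :=
    hf.comp (g := fun x : α × β × List σ => (x.1, x.2.1)) (by fun_prop)
  refine (foldr_comp (h := fun a x acc => f a x ++ acc) hl (Computable.const []) ?_).of_eq ?_
  · fun_prop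
  · intro a
    induction l a with
    | nil => rfl
    | cons x l ih => simp_all

/-- A total function with a computable graph is computable, by unbounded search. -/
theorem of_graph {f : α → ℕ} (hf : ComputablePred fun x : α × ℕ => f x.1 = x.2) :
    Computable f := by
  classical
  refine (Computable.find (P := fun a n => f a = n) hf fun a => ⟨_, rfl⟩).of_eq fun a => ?_
  exact (Nat.find_spec (⟨_, rfl⟩ : ∃ n, f a = n)).symm

end Computable

attribute [fun_prop] Computable.foldr_comp

namespace REPred

/-- A predicate is computably enumerable if and only if it is the projection of a computable
predicate. -/
theorem iff_exists_computablePred {p : α → Prop} :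
    REPred p ↔ ∃ R : α × ℕ → Prop, ComputablePred R ∧ ∀ a, p a ↔ ∃ n, R (a, n) := by
  constructor
  · intro hp
    obtain ⟨c, hc⟩ := Nat.Partrec.Code.exists_code.1 hp
    refine ⟨fun x => (Nat.Partrec.Code.evaln x.2 c (Encodable.encode x.1)).isSome = true, ?_, ?_⟩
    · have := Primrec.option_isSome (α := ℕ) |>.to_comp
      fun_prop
    · intro a
      have h : p a ↔ (c.eval (Encodable.encode a)).Dom := by
        rw [hc]; simp [Part.assert]
      rw [h, Part.dom_iff_mem]
      simp only [Nat.Partrec.Code.evaln_complete, Option.isSome_iff_exists, Option.mem_def]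
      exact exists_comm
  · rintro ⟨R, hR, h⟩
    classical
    have h1 : Partrec fun a => Nat.rfind fun n => Part.some (decide (R (a, n))) :=
      Partrec.rfind hR.decide.partrec
    exact h1.dom_re.of_eq fun a => by
      rw [h]
      refine Nat.rfind_dom'.trans (exists_congr fun n => ?_)
      simp

@[fun_prop]
theorem of_computablePred {p : α → Prop} (hp : ComputablePred p) : REPred p := hp.to_re

@[fun_prop]
theorem eq_comp {f g : α → β} (hf : Computable f) (hg : Computable g) :
    REPred fun a => f a = g a := (ComputablePred.eq_comp hf hg).to_re

@[fun_prop]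
theorem ne_comp {f g : α → β} (hf : Computable f) (hg : Computable g) :
    REPred fun a => f a ≠ g a := (ComputablePred.ne_comp hf hg).to_re

@[fun_prop]
theorem comp_computable {p : β → Prop} {f : α → β} (hp : REPred p) (hf : Computable f) :
    REPred fun a => p (f a) := Partrec.comp hp hf

@[fun_prop]
theorem exists_comp {p : α → ℕ → Prop} (hp : REPred fun x : α × ℕ => p x.1 x.2) :
    REPred fun a => ∃ n, p a n := by
  obtain ⟨R, hR, h⟩ := iff_exists_computablePred.1 hp
  refine iff_exists_computablePred.2 ⟨fun x => R ((x.1, x.2.unpair.1), x.2.unpair.2), by fun_prop,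
    fun a => ⟨?_, ?_⟩⟩
  · rintro ⟨n, hn⟩
    obtain ⟨m, hm⟩ := (h (a, n)).1 hn
    exact ⟨Nat.pair n m, by simpa using hm⟩
  · rintro ⟨n, hn⟩
    exact ⟨n.unpair.1, (h _).2 ⟨_, hn⟩⟩

@[fun_prop]
theorem and_comp {p q : α → Prop} (hp : REPred p) (hq : REPred q) :
    REPred fun a => p a ∧ q a := by
  obtain ⟨R, hR, h⟩ := iff_exists_computablePred.1 hp
  obtain ⟨R', hR', h'⟩ := iff_exists_computablePred.1 hq
  have h1 : ComputablePred fun x : (α × ℕ) × ℕ => R (x.1.1, x.1.2) ∧ R' (x.1.1, x.2) := by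
    fun_prop
  have : REPred fun a => ∃ n m, R (a, n) ∧ R' (a, m) := exists_comp (exists_comp h1.to_re)
  exact this.of_eq fun a => by rw [h, h']; simp

@[fun_prop]
theorem or_comp {p q : α → Prop} (hp : REPred p) (hq : REPred q) :
    REPred fun a => p a ∨ q a := by
  obtain ⟨R, hR, h⟩ := iff_exists_computablePred.1 hp
  obtain ⟨R', hR', h'⟩ := iff_exists_computablePred.1 hq
  have h1 : ComputablePred fun x : α × ℕ => R (x.1, x.2) ∨ R' (x.1, x.2) := by fun_prop
  have : REPred fun a => ∃ n, R (a, n) ∨ R' (a, n) := exists_comp h1.to_re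
  exact this.of_eq fun a => by rw [h, h', exists_or]

/-- A partial computable function selects a value in each nonempty section of a computably
enumerable relation. -/
theorem exists_selector {G : ℕ → ℕ → Prop} (hG : REPred fun x : ℕ × ℕ => G x.1 x.2) :
    ∃ q : ℕ →. ℕ, Nat.Partrec q ∧ ∀ m, (∃ n, G m n) → ∃ n ∈ q m, G m n := by
  classical
  obtain ⟨R, hR, h⟩ := iff_exists_computablePred.1 hG
  have hq : Partrec fun m : ℕ =>
      (Nat.rfind fun t => Part.some (decide (R ((m, t.unpair.1), t.unpair.2)))).map
        fun t => t.unpair.1 := by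
    have h1 : Computable fun x : ℕ × ℕ => decide (R ((x.1, x.2.unpair.1), x.2.unpair.2)) := by
      fun_prop
    have h2 : Computable fun x : ℕ × ℕ => x.2.unpair.1 := by fun_prop
    exact (Partrec.rfind (p := fun m t => Part.some (decide (R ((m, t.unpair.1), t.unpair.2))))
      h1.partrec).map h2
  refine ⟨_, Partrec.nat_iff.1 hq, fun m ⟨n, hn⟩ => ?_⟩
  obtain ⟨k, hk⟩ := (h (m, n)).1 hn
  obtain ⟨t, ht, -⟩ := Nat.rfind_min' (p := fun t => decide (R ((m, t.unpair.1), t.unpair.2)))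
    (m := Nat.pair n k) (by simpa using hk)
  refine ⟨t.unpair.1, Part.mem_map _ ht, (h (m, t.unpair.1)).2 ⟨t.unpair.2, ?_⟩⟩
  simpa using Nat.rfind_spec ht

end REPred

end ComputableTools

/-! ### The tree construction -/

namespace Guessing

open Nat.Partrec (Code)

/-- The first component of the requirement number `k = ⟨x, y, a⟩`. -/
def fstReq (k : ℕ) : ℕ := k.unpair.1

/-- The second component of the requirement number `k = ⟨x, y, a⟩`. -/
def sndReq (k : ℕ) : ℕ := k.unpair.2.unpair.1

/-- The third component of the requirement number `k = ⟨x, y, a⟩`. -/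
def trdReq (k : ℕ) : ℕ := k.unpair.2.unpair.2

@[fun_prop]
theorem computable_fstReq : Computable fstReq := by unfold fstReq; fun_prop

@[fun_prop]
theorem computable_sndReq : Computable sndReq := by unfold sndReq; fun_prop

@[fun_prop]
theorem computable_trdReq : Computable trdReq := by unfold trdReq; fun_prop

theorem exists_req (x y a : ℕ) : ∃ k, fstReq k = x ∧ sndReq k = y ∧ trdReq k = a :=
  ⟨Nat.pair x (Nat.pair y a), by simp [fstReq, sndReq, trdReq]⟩

/-- A substitution on labels, given by a list of replacements that are carried out from the end
of the list to its head. -/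
def relabel (st : List (ℕ × ℕ)) (z : ℕ) : ℕ :=
  st.foldr (fun p l => if l = p.1 then p.2 else l) z

/-- The substitution that merges the labels of `x` and `y` for each requirement `k = ⟨x, y, a⟩`,
`k < n`, that the node `σ` guesses to be true. A node of the tree is a list of guesses, and
`σ[k] = false` is the guess that the `Π⁰₂` condition with number `k` is true, so that in the
lexicographic order of lists this guess comes first. -/
def mergers (σ : List Bool) (n : ℕ) : List (ℕ × ℕ) :=
  Nat.rec [] (fun k st => if σ[k]? = some false then
    (relabel st (sndReq k), relabel st (fstReq k)) :: st else st) n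

/-- The label of `z` according to the node `σ`. Two numbers have the same label if they are
equivalent under the equivalence relation generated by the pairs `(x, y)` such that `σ` guesses
that some condition `k = ⟨x, y, a⟩` is true. -/
def label (σ : List Bool) (z : ℕ) : ℕ := relabel (mergers σ σ.length) z

@[fun_prop]
theorem computable_relabel {α : Type*} [Primcodable α] {f : α → List (ℕ × ℕ)} {g : α → ℕ}
    (hf : Computable f) (hg : Computable g) : Computable fun a => relabel (f a) (g a) := by
  unfold relabel; fun_prop

@[fun_prop]
theorem computable_mergers {α : Type*} [Primcodable α] {f : α → List Bool} {g : α → ℕ}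
    (hf : Computable f) (hg : Computable g) : Computable fun a => mergers (f a) (g a) := by
  unfold mergers; fun_prop

@[fun_prop]
theorem computable_label {α : Type*} [Primcodable α] {f : α → List Bool} {g : α → ℕ}
    (hf : Computable f) (hg : Computable g) : Computable fun a => label (f a) (g a) := by
  unfold label; fun_prop

theorem relabel_mergers_succ (σ : List Bool) (n z : ℕ) : relabel (mergers σ (n + 1)) z =
    if σ[n]? = some false ∧ relabel (mergers σ n) z = relabel (mergers σ n) (sndReq n) then
      relabel (mergers σ n) (fstReq n) else relabel (mergers σ n) z := by
  by_cases h : σ[n]? = some false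
  · have : mergers σ (n + 1) = (relabel (mergers σ n) (sndReq n),
        relabel (mergers σ n) (fstReq n)) :: mergers σ n := if_pos h
    rw [this]
    simp only [h, true_and]
    rfl
  · have : mergers σ (n + 1) = mergers σ n := if_neg h
    simp [this, h]

theorem relabel_mergers_eq_of_le {σ : List Bool} {m n z w : ℕ} (hmn : m ≤ n)
    (h : relabel (mergers σ m) z = relabel (mergers σ m) w) :
    relabel (mergers σ n) z = relabel (mergers σ n) w := by
  induction n, hmn using Nat.le_induction with
  | base => exact h
  | succ n _ ih => rw [relabel_mergers_succ, relabel_mergers_succ, ih]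

theorem label_fstReq_eq {σ : List Bool} {k : ℕ} (h : σ[k]? = some false) :
    label σ (fstReq k) = label σ (sndReq k) := by
  obtain ⟨hk, -⟩ := List.getElem?_eq_some_iff.1 h
  refine relabel_mergers_eq_of_le (m := k + 1) hk ?_
  rw [relabel_mergers_succ, relabel_mergers_succ, if_pos (⟨h, rfl⟩ : _ ∧ _ = _)]
  split_ifs <;> rfl

/-- If the guesses of `σ` are correct, then each number is `S`-related to its label. -/
theorem rel_label {S : ℕ → ℕ → Prop} (hS : Equivalence S) {σ : List Bool}
    (h : ∀ j, σ[j]? = some false → S (fstReq j) (sndReq j)) (z : ℕ) : S (label σ z) z := by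
  unfold label
  induction σ.length generalizing z with
  | zero => exact hS.refl z
  | succ n ih =>
    rw [relabel_mergers_succ]
    split_ifs with hc
    · have h1 := ih (sndReq n)
      rw [← hc.2] at h1
      exact hS.trans (ih _) (hS.trans (h n hc.1) (hS.trans (hS.symm h1) (ih z)))
    · exact ih z

/-- The lexicographic order in terms of bounded quantifiers. -/
theorem list_bool_lt_iff (σ ρ : List Bool) : σ < ρ ↔
    (σ = ρ.take σ.length ∧ σ.length < ρ.length) ∨
      ∃ i < σ.length, σ.take i = ρ.take i ∧ σ[i]? = some false ∧ ρ[i]? = some true := by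
  rw [List.lt_iff_exists]
  refine or_congr Iff.rfl ⟨?_, ?_⟩
  · rintro ⟨i, h1, h2, h, hlt⟩
    rw [Bool.lt_iff] at hlt
    refine ⟨i, h1, List.ext_getElem (by simp; omega) fun j hj hj' => ?_, ?_, ?_⟩
    · simpa using h j (by simp at hj; omega)
    · rw [List.getElem?_eq_getElem h1, hlt.1]
    · rw [List.getElem?_eq_getElem h2, hlt.2]
  · rintro ⟨i, h1, h, hf, ht⟩
    obtain ⟨h2, ht'⟩ := List.getElem?_eq_some_iff.1 ht
    obtain ⟨_, hf'⟩ := List.getElem?_eq_some_iff.1 hf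
    refine ⟨i, h1, h2, fun j hj => ?_, by rw [hf', ht']; decide⟩
    have := congrArg (·[j]?) h
    simpa [List.getElem?_take, hj, hj.trans h1, hj.trans h2] using this

@[fun_prop]
theorem computablePred_list_lt {α : Type*} [Primcodable α] {f g : α → List Bool}
    (hf : Computable f) (hg : Computable g) : ComputablePred fun a => f a < g a := by
  simp only [list_bool_lt_iff]; fun_prop

variable (P : ℕ × ℕ × ℕ × ℕ × ℕ → Prop)

/-- At stage `s`, the approximation to the `Π⁰₂` condition `∀ b, ∃ c, P (x, y, a, b, c)` with
number `k = ⟨x, y, a⟩` has been verified for all `b ≤ n`. -/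
def Verified (k n s : ℕ) : Prop :=
  ∀ b ≤ n, ∃ c ≤ s, P (fstReq k, sndReq k, trdReq k, b, c)

/-- The `Π⁰₂` condition with number `k` is true. Equivalently, each `n` is
reached by the approximation `Verified P k n s` at some stage `s`. -/
def Infinite (k : ℕ) : Prop := ∀ b, ∃ c, P (fstReq k, sndReq k, trdReq k, b, c)

/-- At stage `s`, the conditions that the node `σ` guesses to be true look true up to `t + |σ|`. -/
def Permitted (σ : List Bool) (t s : ℕ) : Prop :=
  ∀ j < σ.length, σ[j]? = some false → Verified P j (t + σ.length) s

/-- At stage `s`, a node to the left of `σ` looks true up to `t`. -/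
def Cancelled (σ : List Bool) (t s : ℕ) : Prop :=
  ∃ j < σ.length, σ[j]? = some true ∧ Verified P j t s ∧
    ∀ i < j, σ[i]? = some false → Verified P i t s

/-- The witness `⟨σ, t⟩` that is considered at stage `s`. Each witness is considered at infinitely
many stages. -/
def witness (s : ℕ) : List Bool × ℕ :=
  let d : List Bool × ℕ × ℕ := (Encodable.decode s).getD ([], 0, 0)
  (d.1, d.2.1)

/-- The number `z` and the node of `w` agree about the class whose sets receive `w`. -/
def Targets (w : List Bool × ℕ) (z : ℕ) : Prop :=
  label w.1 z = label w.1 (fstReq w.1.length)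

/-- Membership of `w` in the set with number `z`, where `H` is the list of the stages at which
some node has acted. -/
def InSet (H : List ℕ) (z : ℕ) (w : List Bool × ℕ) : Prop :=
  w = ([], 0) ∨ (Targets w z ∧ ∃ u ∈ H, witness u = w)

/-- The node `σ` of the witness `⟨σ, t⟩` acts at stage `s`, where `H` is the list of the earlier
stages at which some node has acted. Let `|σ| = ⟨x, y, e⟩`. The witness has to be permitted and
must not be cancelled; neither `σ` nor a node that precedes it has acted since stage `t`; if `σ`
has acted before, then a node that precedes it has acted since; and the computation of the `e`-th
function at the witness has halted with a value that is not in the set with number `y`. -/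
def ActsAfter (s : ℕ) (H : List ℕ) : Prop :=
  Permitted P (witness s).1 (witness s).2 s ∧ ¬ Cancelled P (witness s).1 (witness s).2 s ∧
  ¬ Targets (witness s) (sndReq (witness s).1.length) ∧
  (∀ u ∈ H, ((witness s).2 ≤ u → (witness s).1 < (witness u).1) ∧
    ((witness u).1 = (witness s).1 → ∃ v ∈ H, u < v ∧ (witness v).1 < (witness s).1)) ∧
  ∃ w ∈ ((Code.evaln s (Denumerable.ofNat Code (trdReq (witness s).1.length))
      (Encodable.encode (witness s))).bind
        (Encodable.decode : ℕ → Option (List Bool × ℕ))).toList,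
    w.2 ≤ s ∧ ¬ InSet H (sndReq (witness s).1.length) w

open Classical in
/-- The list of the stages before `s` at which some node acts. -/
noncomputable def history (s : ℕ) : List ℕ :=
  Nat.rec [] (fun s H => if ActsAfter P s H then s :: H else H) s

/-- Some node acts at stage `s`. -/
def Acts (s : ℕ) : Prop := ActsAfter P s (history P s)

/-- Membership of `w` in the set with number `z` that is constructed. The witness `([], 0)`
belongs to all of the sets; as the root never acts, `([], 1)` belongs to none of them. -/
def InLimit (z : ℕ) (w : List Bool × ℕ) : Prop :=
  w = ([], 0) ∨ (Targets w z ∧ ∃ u, Acts P u ∧ witness u = w)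

@[fun_prop]
theorem computable_witness : Computable witness := by unfold witness; fun_prop

@[fun_prop]
theorem computablePred_targets {α : Type*} [Primcodable α] {f : α → List Bool × ℕ} {g : α → ℕ}
    (hf : Computable f) (hg : Computable g) : ComputablePred fun a => Targets (f a) (g a) := by
  unfold Targets; fun_prop

@[fun_prop]
theorem computablePred_inSet {α : Type*} [Primcodable α] {h : α → List ℕ} {f : α → List Bool × ℕ}
    {g : α → ℕ} (hh : Computable h) (hf : Computable f) (hg : Computable g) :
    ComputablePred fun a => InSet (h a) (g a) (f a) := by
  unfold InSet; fun_prop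

variable {P}

theorem computablePred_verified (hP : ComputablePred P) {α : Type*} [Primcodable α] {f g h : α → ℕ}
    (hf : Computable f) (hg : Computable g) (hh : Computable h) :
    ComputablePred fun a => Verified P (f a) (g a) (h a) := by
  unfold Verified; fun_prop

theorem computablePred_cancelled (hP : ComputablePred P) {α : Type*} [Primcodable α]
    {f : α → List Bool} {g h : α → ℕ} (hf : Computable f) (hg : Computable g) (hh : Computable h) :
    ComputablePred fun a => Cancelled P (f a) (g a) (h a) := by
  have := @computablePred_verified P hP
  unfold Cancelled; fun_prop

theorem computablePred_permitted (hP : ComputablePred P) {α : Type*} [Primcodable α]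
    {f : α → List Bool} {g h : α → ℕ} (hf : Computable f) (hg : Computable g) (hh : Computable h) :
    ComputablePred fun a => Permitted P (f a) (g a) (h a) := by
  unfold Permitted Verified; fun_prop

theorem computablePred_actsAfter (hP : ComputablePred P) :
    ComputablePred fun x : ℕ × List ℕ => ActsAfter P x.1 x.2 := by
  have h1 : ComputablePred fun x : ℕ × List ℕ =>
      Permitted P (witness x.1).1 (witness x.1).2 x.1 :=
    computablePred_permitted hP (by fun_prop) (by fun_prop) (by fun_prop)
  have h2 : ComputablePred fun x : ℕ × List ℕ =>
      Cancelled P (witness x.1).1 (witness x.1).2 x.1 :=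
    computablePred_cancelled hP (by fun_prop) (by fun_prop) (by fun_prop)
  unfold ActsAfter; fun_prop

theorem computable_history (hP : ComputablePred P) : Computable (history P) := by
  have := computablePred_actsAfter hP
  unfold history; fun_prop

theorem computablePred_acts (hP : ComputablePred P) : ComputablePred (Acts P) :=
  ComputablePred.comp_computable (p := fun x : ℕ × List ℕ => ActsAfter P x.1 x.2)
    (f := fun s => (s, history P s)) (computablePred_actsAfter hP)
    (Computable.id.pair (computable_history hP))

theorem rePred_inLimit (hP : ComputablePred P) :
    REPred fun x : ℕ × List Bool × ℕ => InLimit P x.1 x.2 := by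
  have := computablePred_acts hP
  unfold InLimit; fun_prop

end Guessing

/-! ### Reductions between the constructed sets -/

namespace Guessing

open Nat.Partrec (Code)
open Filter

variable {P : ℕ × ℕ × ℕ × ℕ × ℕ → Prop}

theorem Verified.mono {k n m s t : ℕ} (h : Verified P k n s) (hm : m ≤ n) (hs : s ≤ t) :
    Verified P k m t := fun b hb =>
  let ⟨c, hc, hp⟩ := h b (hb.trans hm)
  ⟨c, hc.trans hs, hp⟩

theorem Infinite.eventually_verified {k : ℕ} (h : Infinite P k) (n : ℕ) :
    ∀ᶠ s in atTop, Verified P k n s := by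
  choose c hc using h
  filter_upwards [eventually_ge_atTop ((Finset.range (n + 1)).sup c)] with s hs b hb
  exact ⟨c b, (Finset.le_sup (by simp; omega)).trans hs, hc b⟩

theorem exists_forall_not_verified {k : ℕ} (h : ¬ Infinite P k) :
    ∃ b, ∀ n ≥ b, ∀ s, ¬ Verified P k n s := by
  simp only [Infinite, not_forall] at h
  obtain ⟨b, hb⟩ := h
  exact ⟨b, fun n hn s hv => hb ((hv b hn).imp fun c hc => hc.2)⟩

open Classical in
/-- The node of length `n` all of whose guesses are correct. -/
noncomputable def truePath (P : ℕ × ℕ × ℕ × ℕ × ℕ → Prop) (n : ℕ) : List Bool :=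
  (List.range n).map fun j => decide (¬ Infinite P j)

@[simp]
theorem length_truePath (n : ℕ) : (truePath P n).length = n := by simp [truePath]

theorem truePath_eq_false_iff {n j : ℕ} :
    (truePath P n)[j]? = some false ↔ j < n ∧ Infinite P j := by
  by_cases h : j < n <;> simp [truePath, h]

theorem truePath_eq_true_iff {n j : ℕ} :
    (truePath P n)[j]? = some true ↔ j < n ∧ ¬ Infinite P j := by
  by_cases h : j < n <;> simp [truePath, h]

theorem take_truePath {m n : ℕ} (h : m ≤ n) : (truePath P n).take m = truePath P m := by
  simp only [truePath, ← List.map_take, List.take_range, min_eq_left h]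

theorem eventually_permitted (n t : ℕ) : ∀ᶠ s in atTop, Permitted P (truePath P n) t s := by
  have h : ∀ j ∈ Finset.range n, ∀ᶠ s in atTop,
      ((truePath P n)[j]? = some false → Verified P j (t + n) s) := by
    intro j _
    by_cases hj : Infinite P j
    · exact (hj.eventually_verified (t + n)).mono fun s hs _ => hs
    · exact Eventually.of_forall fun s hs => absurd (truePath_eq_false_iff.1 hs).2 hj
  filter_upwards [(eventually_all_finset _).2 h] with s hs j hj
  simpa using hs j (by simpa using hj)

theorem eventually_not_cancelled (n : ℕ) :
    ∀ᶠ t in atTop, ∀ s, ¬ Cancelled P (truePath P n) t s := by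
  have h : ∀ j ∈ Finset.range n, ∀ᶠ t in atTop,
      ((truePath P n)[j]? = some true → ∀ s, ¬ Verified P j t s) := by
    intro j _
    by_cases hj : Infinite P j
    · exact Eventually.of_forall fun s hs => absurd hj (truePath_eq_true_iff.1 hs).2
    · obtain ⟨b, hb⟩ := exists_forall_not_verified hj
      filter_upwards [eventually_ge_atTop b] with t ht _ s using hb t ht s
  filter_upwards [(eventually_all_finset _).2 h] with t ht s hc
  obtain ⟨j, hj, hjt, hv, -⟩ := hc
  exact ht j (by simpa using hj) hjt s hv

theorem Cancelled.mono {σ : List Bool} {t r s : ℕ} (h : Cancelled P σ t r) (hs : r ≤ s) :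
    Cancelled P σ t s :=
  let ⟨j, hj, hjt, hv, hi⟩ := h
  ⟨j, hj, hjt, hv.mono le_rfl hs, fun i hij hf => (hi i hij hf).mono le_rfl hs⟩

/-- A node to the right of the true path is eventually cancelled. -/
theorem exists_cancelled {n : ℕ} {σ : List Bool} (h : truePath P n < σ)
    (hpre : ¬ truePath P n <+: σ) (t : ℕ) : ∃ s, Cancelled P σ t s := by
  rcases (list_bool_lt_iff _ _).1 h with ⟨h1, -⟩ | ⟨i, hi, htake, hf, ht⟩
  · exact absurd (List.prefix_iff_eq_take.2 h1) hpre
  · have hin : i < n := by simpa using hi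
    have hagree : ∀ j < i, σ[j]? = (truePath P n)[j]? := fun j hj => by
      have := congrArg (·[j]?) htake
      simpa [List.getElem?_take, hj] using this.symm
    have hv : ∀ j ∈ Finset.range (i + 1), ∀ᶠ s in atTop,
        ((truePath P n)[j]? = some false → Verified P j t s) := by
      intro j _
      by_cases hj : Infinite P j
      · exact (hj.eventually_verified t).mono fun s hs _ => hs
      · exact Eventually.of_forall fun s hs => absurd (truePath_eq_false_iff.1 hs).2 hj
    obtain ⟨s, hs⟩ := ((eventually_all_finset _).2 hv).exists
    refine ⟨s, i, (List.getElem?_eq_some_iff.1 ht).1, ht, hs i (by simp) hf, fun j hj hjf => ?_⟩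
    exact hs j (by simp; omega) (by rw [← hagree j hj, hjf])

theorem witness_snd_le (s : ℕ) : (witness s).2 ≤ s := by
  unfold witness
  cases h : (Encodable.decode s : Option (List Bool × ℕ × ℕ)) with
  | none => simp
  | some d =>
    obtain ⟨σ, t, r⟩ := d
    simp only [Encodable.decode_prod_val, Option.bind_eq_some_iff, Option.map_eq_some_iff,
      Encodable.decode_nat, Option.some.injEq, Prod.mk.injEq] at h
    obtain ⟨_, -, _, ⟨_, rfl, _, -, rfl⟩, -, h⟩ := h
    rw [Prod.mk.injEq] at h
    simp only [Option.getD_some, ← h.1]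
    exact (Nat.unpair_left_le _).trans (Nat.unpair_right_le _)

theorem exists_witness_eq (w : List Bool × ℕ) (n : ℕ) : ∃ s ≥ n, witness s = w := by
  refine ⟨Encodable.encode (w.1, w.2, n), ?_, by simp [witness]⟩
  exact (Nat.right_le_pair _ _).trans (Nat.right_le_pair _ _)

theorem mem_history {s u : ℕ} : u ∈ history P s ↔ u < s ∧ Acts P u := by
  classical
  induction s with
  | zero => simp [history]
  | succ s ih =>
    have h : history P (s + 1) =
      if ActsAfter P s (history P s) then s :: history P s else history P s := rfl
    rw [h]
    split_ifs with hs
    · rw [List.mem_cons, ih]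
      constructor
      · rintro (rfl | ⟨h1, h2⟩)
        · exact ⟨by omega, hs⟩
        · exact ⟨by omega, h2⟩
      · rintro ⟨h1, h2⟩
        rcases Nat.lt_succ_iff_lt_or_eq.1 h1 with h1 | rfl
        · exact Or.inr ⟨h1, h2⟩
        · exact Or.inl rfl
    · rw [ih]
      constructor
      · rintro ⟨h1, h2⟩
        exact ⟨by omega, h2⟩
      · rintro ⟨h1, h2⟩
        refine ⟨lt_of_le_of_ne (by omega) ?_, h2⟩
        rintro rfl
        exact hs h2

/-- A node does not use the same witness twice, since it may use a witness `⟨σ, t⟩` only if it has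
not acted since stage `t`. -/
theorem Acts.injective {u v : ℕ} (hu : Acts P u) (hv : Acts P v) (h : witness u = witness v) :
    u = v := by
  wlog huv : u < v generalizing u v with H
  · rcases lt_trichotomy u v with h1 | h1 | h1
    · exact H hu hv h h1
    · exact h1
    · exact (H hv hu h.symm h1).symm
  have := (hv.2.2.2.1 u (mem_history.2 ⟨huv, hu⟩)).1 (h ▸ witness_snd_le u)
  rw [h] at this
  exact absurd this (lt_irrefl _)

theorem label_nil (z : ℕ) : label [] z = z := rfl

theorem Acts.witness_ne_nil {u : ℕ} (hu : Acts P u) : (witness u).1 ≠ [] := by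
  intro h
  apply hu.2.2.1
  simp [Targets, h, label_nil, fstReq, sndReq]

/-- A node to the left of the true path is permitted to act for finitely many witnesses only. -/
theorem finite_acts_left {i : ℕ} (hi : ¬ Infinite P i) :
    {u | Acts P u ∧ (witness u).1[i]? = some false}.Finite := by
  obtain ⟨b, hb⟩ := exists_forall_not_verified hi
  refine Set.Finite.of_finite_image (f := witness)
    (((List.finite_length_lt Bool b).prod (Set.finite_lt_nat b)).subset ?_)
    (fun u hu v hv h => hu.1.injective hv.1 h)
  rintro _ ⟨u, ⟨hu, hf⟩, rfl⟩
  have := hu.1 i (List.getElem?_eq_some_iff.1 hf).1 hf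
  have hlt : (witness u).2 + (witness u).1.length < b := by
    by_contra hc
    exact hb _ (not_lt.1 hc) _ this
  exact ⟨show (witness u).1.length < b by omega, show (witness u).2 < b by omega⟩

/-- The nodes that precede a node on the true path act only finitely often, if this is true of its
proper initial segments: each of the others wrongly guesses that some condition is true. -/
theorem finite_acts_lt (n : ℕ) (h : ∀ m < n, {u | Acts P u ∧ (witness u).1 = truePath P m}.Finite) :
    {u | Acts P u ∧ (witness u).1 < truePath P n}.Finite := by
  have h1 : (⋃ m ∈ Finset.range n, {u | Acts P u ∧ (witness u).1 = truePath P m}).Finite :=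
    Set.Finite.biUnion (Finset.finite_toSet _) fun m hm => h m (by simpa using hm)
  have h2 : (⋃ i ∈ {i | i ∈ Finset.range n ∧ ¬ Infinite P i},
      {u | Acts P u ∧ (witness u).1[i]? = some false}).Finite :=
    Set.Finite.biUnion ((Finset.finite_toSet (Finset.range n)).subset fun i hi => hi.1)
      fun i hi => finite_acts_left hi.2
  refine (h1.union h2).subset ?_
  rintro u ⟨hu, hlt⟩
  rcases (list_bool_lt_iff _ _).1 hlt with ⟨h3, h4⟩ | ⟨i, hi, htake, hf, ht⟩
  · left
    rw [length_truePath] at h4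
    rw [take_truePath h4.le] at h3
    simp only [Set.mem_iUnion]
    exact ⟨_, Finset.mem_range.2 h4, hu, h3⟩
  · right
    have := truePath_eq_true_iff.1 ht
    simp only [Set.mem_iUnion]
    exact ⟨i, ⟨Finset.mem_range.2 this.1, this.2⟩, hu, hf⟩

/-- A node on the true path acts only finitely often, since it acts at most once after the last
action of a node that precedes it. -/
theorem finite_acts_eq (n : ℕ) : {u | Acts P u ∧ (witness u).1 = truePath P n}.Finite := by
  induction n using Nat.strong_induction_on with
  | _ n ih =>
    obtain ⟨U, hU⟩ := (finite_acts_lt n ih).bddAbove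
    have key : {u | U < u ∧ Acts P u ∧ (witness u).1 = truePath P n}.Subsingleton := by
      intro u hu v hv
      wlog huv : u < v generalizing u v with H
      · rcases lt_trichotomy u v with h1 | h1 | h1
        · exact H hu hv h1
        · exact h1
        · exact (H hv hu h1).symm
      obtain ⟨r, hr, hur, hlt⟩ := (hv.2.1.2.2.2.1 u (mem_history.2 ⟨huv, hu.2.1⟩)).2
        (hu.2.2.trans hv.2.2.symm)
      have : r ≤ U := hU ⟨(mem_history.1 hr).2, hv.2.2 ▸ hlt⟩
      have := hu.1
      omega
    refine ((Set.finite_le_nat U).union key.finite).subset fun u hu => ?_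
    rcases le_or_gt u U with h | h
    · exact Or.inl h
    · exact Or.inr ⟨h, hu⟩

theorem finite_acts_le (n : ℕ) : {u | Acts P u ∧ (witness u).1 ≤ truePath P n}.Finite := by
  refine ((finite_acts_lt (P := P) n fun m _ => finite_acts_eq m).union
    (finite_acts_eq (P := P) n)).subset ?_
  rintro u ⟨hu, h⟩
  rcases h.lt_or_eq with h | h
  · exact Or.inl ⟨hu, h⟩
  · exact Or.inr ⟨hu, h⟩

theorem not_inLimit_nil_one (z : ℕ) : ¬ InLimit P z ([], 1) := by
  rintro (h | ⟨-, u, hu, h⟩)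
  · simp at h
  · exact hu.witness_ne_nil (by rw [h])

/-- Off the cone above a node on the true path, membership in each of the sets is decidable:
a witness to the right is cancelled at some stage, and only finitely many others act. -/
theorem computablePred_inLimit_off_cone (hP : ComputablePred P) (n z : ℕ) :
    ComputablePred fun w : List Bool × ℕ => ¬ truePath P n <+: w.1 ∧ InLimit P z w := by
  classical
  set τ := truePath P n with hτ
  have hF : {w : List Bool × ℕ | w.1 ≤ τ ∧ InLimit P z w}.Finite := by
    refine (((finite_acts_le (P := P) n).image witness).union
      (Set.finite_singleton ([], 0))).subset ?_
    rintro w ⟨hw, h | ⟨-, u, hu, rfl⟩⟩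
    · exact Or.inr h
    · exact Or.inl ⟨u, ⟨hu, hw⟩, rfl⟩
  -- a bound for the stages at which a witness to the right of `τ` can act
  have hex : ∀ w : List Bool × ℕ, ∃ s, ¬ (τ < w.1 ∧ ¬ τ <+: w.1) ∨ Cancelled P w.1 w.2 s := by
    intro w
    by_cases h : τ < w.1 ∧ ¬ τ <+: w.1
    · obtain ⟨s, hs⟩ := exists_cancelled h.1 h.2 w.2
      exact ⟨s, Or.inr hs⟩
    · exact ⟨0, Or.inl h⟩
  have hcan : ComputablePred fun x : (List Bool × ℕ) × ℕ => Cancelled P x.1.1 x.1.2 x.2 :=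
    computablePred_cancelled hP (by fun_prop) (by fun_prop) (by fun_prop)
  obtain ⟨b, hb, hspec⟩ : ∃ b : List Bool × ℕ → ℕ, Computable b ∧
      ∀ w, ¬ (τ < w.1 ∧ ¬ τ <+: w.1) ∨ Cancelled P w.1 w.2 (b w) := by
    refine ⟨_, Computable.find (P := fun (w : List Bool × ℕ) s =>
      ¬ (τ < w.1 ∧ ¬ τ <+: w.1) ∨ Cancelled P w.1 w.2 s) ?_ hex, fun w => Nat.find_spec (hex w)⟩
    fun_prop
  have hacts := computablePred_acts hP
  have hmem := ComputablePred.mem_finite hF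
  have : ComputablePred fun w : List Bool × ℕ => ¬ τ <+: w.1 ∧
      (w ∈ {w : List Bool × ℕ | w.1 ≤ τ ∧ InLimit P z w} ∨ (τ < w.1 ∧ (w = ([], 0) ∨
        (Targets w z ∧ ∃ u < b w, Acts P u ∧ witness u = w)))) := by fun_prop
  refine this.of_eq fun w => and_congr_right fun hw => ?_
  rcases le_or_gt w.1 τ with h | h
  · simp [h, not_lt.2 h]
  · simp only [Set.mem_ofPred_eq, not_le.2 h, false_and, h, true_and, false_or, InLimit]
    refine or_congr Iff.rfl (and_congr_right fun _ => exists_congr fun u => ?_)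
    refine ⟨fun hu => hu.2, fun hu => ⟨?_, hu⟩⟩
    by_contra hc
    have := (hspec w).resolve_left (not_not.2 ⟨h, hw⟩)
    refine hu.1.2.1 ?_
    rw [hu.2]
    exact this.mono (not_lt.1 hc)

/-- If the condition `k = ⟨x, y, a⟩` is true, then the nodes that extend the first `k + 1` correct
guesses put their witnesses into both or none of the sets with the numbers `x` and `y`. Other
witnesses are sent to a fixed element or a fixed non-element. -/
theorem manyOneReducible_of_infinite (hP : ComputablePred P) {k : ℕ} (hk : Infinite P k)
    {z w : ℕ} (h : z = fstReq k ∧ w = sndReq k ∨ z = sndReq k ∧ w = fstReq k) :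
    InLimit P z ≤₀ InLimit P w := by
  classical
  set τ := truePath P (k + 1) with hτ
  have h1 := computablePred_inLimit_off_cone hP (k + 1) z
  refine ⟨fun v => if τ <+: v.1 then v else
    if ¬ τ <+: v.1 ∧ InLimit P z v then ([], 0) else ([], 1), by fun_prop, fun v => ?_⟩
  by_cases hv : τ <+: v.1
  · have hlab : label v.1 z = label v.1 w := by
      have : v.1[k]? = some false := by
        obtain ⟨l, hl⟩ := hv
        rw [← hl, List.getElem?_append_left (by simp [hτ])]
        exact truePath_eq_false_iff.2 ⟨by omega, hk⟩
      have := label_fstReq_eq this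
      rcases h with ⟨rfl, rfl⟩ | ⟨rfl, rfl⟩
      · exact this
      · exact this.symm
    simp [hv, InLimit, Targets, hlab]
  · by_cases hz : InLimit P z v
    · simp only [hv, hz, if_true, if_false, not_false_eq_true, and_self, true_iff]
      exact Or.inl rfl
    · simp [hv, hz, not_inLimit_nil_one]

/-- The diagonalization succeeds for a node on the true path that does not identify `z` and `w`. -/
theorem not_manyOneReducible {S : ℕ → ℕ → Prop} (hS : Equivalence S)
    (hPS : ∀ j, Infinite P j → S (fstReq j) (sndReq j)) {z w : ℕ} (hzw : ¬ S z w) :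
    ¬ InLimit P z ≤₀ InLimit P w := by
  rintro ⟨f, hf, hred⟩
  obtain ⟨c, hc⟩ := Nat.Partrec.Code.exists_code.1 hf
  obtain ⟨k, rfl, rfl, hke⟩ := exists_req z w (Encodable.encode c)
  set σ := truePath P k with hσ
  have hlab : label σ (fstReq k) ≠ label σ (sndReq k) := by
    intro h
    have hl := rel_label hS (σ := σ) fun j hj => hPS j (truePath_eq_false_iff.1 hj).2
    have h1 := hl (fstReq k)
    rw [h] at h1
    exact hzw (hS.trans (hS.symm h1) (hl (sndReq k)))
  have heval : ∀ v, Encodable.encode (f v) ∈ c.eval (Encodable.encode v) := fun v => by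
    rw [hc]; simp
  obtain ⟨U, hU⟩ := (finite_acts_lt (P := P) k fun m _ => finite_acts_eq m).bddAbove
  by_cases hA : ∃ u, Acts P u ∧ (witness u).1 = σ ∧ ∀ v > u, Acts P v → ¬ (witness v).1 < σ
  -- the restraint imposed by the last action of `σ` is never injured
  · obtain ⟨u, hu, huσ, hlast⟩ := hA
    obtain ⟨-, -, -, -, v, hv, hvu, hnot⟩ := id hu
    have hin : InLimit P (fstReq k) (witness u) :=
      Or.inr ⟨by simp [Targets, huσ, hσ], u, hu, rfl⟩
    simp only [huσ, hσ, length_truePath, hke, Denumerable.ofNat_encode] at hv hnot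
    have hfv : f (witness u) = v := by
      rw [Option.mem_toList, Option.bind_eq_some_iff] at hv
      obtain ⟨m, hm, hdec⟩ := hv
      have h2 := Part.mem_unique (Code.evaln_sound hm) (heval (witness u))
      rw [h2, Encodable.encodek] at hdec
      exact Option.some.inj hdec
    rw [hred, hfv] at hin
    rcases hin with rfl | ⟨ht, r, hr, rfl⟩
    · exact hnot (Or.inl rfl)
    · rcases lt_trichotomy r u with h | rfl | h
      · exact hnot (Or.inr ⟨ht, r, mem_history.2 ⟨h, hr⟩, rfl⟩)
      · apply hlab
        have := ht
        simp only [Targets, huσ, hσ, length_truePath] at this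
        exact this.symm
      · have := (hr.2.2.2.1 u (mem_history.2 ⟨h, hu⟩)).1 hvu
        exact hlast r h hr (huσ ▸ this)
  -- `σ` stops acting, since its current computation has its value in the second set
  · push Not at hA
    have hbound : ∀ u, Acts P u → (witness u).1 ≤ σ → u ≤ U := by
      intro u hu hle
      rcases hle.lt_or_eq with h | h
      · exact hU ⟨hu, h⟩
      · obtain ⟨v, hv, hva, hlt⟩ := hA u hu h
        exact hv.le.trans (hU ⟨hva, hlt⟩)
    obtain ⟨t, ht, htU⟩ := ((eventually_not_cancelled (P := P) k).and
      (eventually_gt_atTop U)).exists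
    set v := f (σ, t) with hv
    have hnin : ¬ InLimit P (fstReq k) (σ, t) := by
      rintro (h | ⟨-, u, hu, h⟩)
      · have h1 : σ = [] := congrArg Prod.fst h
        have hk0 : k = 0 := by simpa [hσ] using congrArg List.length h1
        apply hlab
        simp [hk0, fstReq, sndReq]
      · have h1 : u ≤ U := hbound u hu (by rw [h])
        have h2 := witness_snd_le u
        rw [h] at h2
        simp only at h2
        omega
    obtain ⟨N, hN⟩ := Code.evaln_complete.1 (heval (σ, t))
    obtain ⟨M, hM⟩ := eventually_atTop.1 (eventually_permitted (P := P) k t)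
    obtain ⟨s, hs, hws⟩ := exists_witness_eq (σ, t) (U + 1 + N + M + v.2)
    have hnact : ¬ Acts P s := fun h => by
      have := hbound s h (by rw [hws])
      omega
    rw [hred] at hnin
    apply hnin
    by_contra hv2
    apply hnact
    unfold Acts ActsAfter
    rw [hws]
    simp only [hσ, length_truePath, hke, Denumerable.ofNat_encode]
    refine ⟨hM s (by omega), ht s, ?_, ?_, v, ?_, by omega, ?_⟩
    · simp only [Targets, length_truePath]
      exact fun h => hlab h.symm
    · intro u hu
      have hu' := mem_history.1 hu
      refine ⟨fun htu => ?_, fun huσ => ?_⟩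
      · by_contra hle
        have := hbound u hu'.2 (not_lt.1 hle)
        omega
      · obtain ⟨r, hur, hr, hlt⟩ := hA u hu'.2 huσ
        have : r ≤ U := hU ⟨hr, hlt⟩
        exact ⟨r, mem_history.2 ⟨by omega, hr⟩, hur, hlt⟩
    · rw [Option.mem_toList, Option.bind_eq_some_iff]
      exact ⟨_, Code.evaln_mono (by omega) hN, by rw [Encodable.encodek]⟩
    · rintro (h | ⟨h1, u, hu, h2⟩)
      · exact hv2 (Or.inl h)
      · exact hv2 (Or.inr ⟨h1, u, (mem_history.1 hu).2, h2⟩)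

end Guessing

open Guessing in
/-- Every `Σ⁰₃` equivalence relation is reducible to `1`-equivalence of computably enumerable sets
that contain all even numbers. -/
theorem IsSigmaThree.exists_oneOneEquiv {S : ℕ → ℕ → Prop} (hS : Equivalence S)
    (h : IsSigmaThree S) : ∃ V : ℕ → Set ℕ, REPred (fun p : ℕ × ℕ => p.2 ∈ V p.1) ∧
      (∀ e x, Even x → x ∈ V e) ∧
      ∀ x y, S x y ↔ OneOneEquiv (fun n => n ∈ V x) (fun n => n ∈ V y) := by
  obtain ⟨P, hP, hSP⟩ := h
  have hPS : ∀ j, Infinite P j → S (fstReq j) (sndReq j) := fun j hj => (hSP _ _).2 ⟨_, hj⟩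
  -- the odd numbers code infinitely many copies of each witness, so that a many-one reduction
  -- yields a one-one reduction
  let dec : ℕ → List Bool × ℕ := fun n => (Encodable.decode (n / 2).unpair.1).getD ([], 1)
  have hdec : Computable dec := by fun_prop
  have hdec' : ∀ v m, dec (2 * Nat.pair (Encodable.encode v) m + 1) = v := fun v m => by
    have : (2 * Nat.pair (Encodable.encode v) m + 1) / 2 = Nat.pair (Encodable.encode v) m := by
      omega
    simp only [dec, this, Nat.unpair_pair, Encodable.encodek, Option.getD_some]
  let V : ℕ → Set ℕ := fun z => {n | n % 2 = 0 ∨ InLimit P z (dec n)}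
  have hVmem : ∀ z n, n ∈ V z ↔ n % 2 = 0 ∨ InLimit P z (dec n) := fun _ _ => Iff.rfl
  have hle : ∀ z w, (fun n => n ∈ V z) ≤₁ (fun n => n ∈ V w) ↔ InLimit P z ≤₀ InLimit P w := by
    intro z w
    constructor
    · rintro ⟨r, hr, -, hred⟩
      let q : List Bool × ℕ → ℕ := fun v => r (2 * Nat.pair (Encodable.encode v) 0 + 1)
      refine ⟨fun v => if q v % 2 = 0 then ([], 0) else dec (q v), by fun_prop, fun v => ?_⟩
      have h1 : _ ∈ V z ↔ _ ∈ V w := hred (2 * Nat.pair (Encodable.encode v) 0 + 1)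
      dsimp only
      rw [hVmem, hVmem, hdec', or_iff_right (by omega)] at h1
      rw [h1]
      split_ifs with h
      · simp only [q] at h
        simp [h, InLimit]
      · simp only [q] at h
        simp [h, q]
    · rintro ⟨f, hf, hred⟩
      refine ⟨fun n => if n % 2 = 0 then n else 2 * Nat.pair (Encodable.encode (f (dec n))) n + 1,
        by fun_prop, fun m n hmn => ?_, fun n => ?_⟩
      · dsimp only at hmn
        split_ifs at hmn with h1 h2 h2
        · exact hmn
        · omega
        · omega
        · exact (Nat.pair_eq_pair.1 (by omega : Nat.pair (Encodable.encode (f (dec m))) m =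
            Nat.pair (Encodable.encode (f (dec n))) n)).2
      · dsimp only
        split_ifs with h
        · simp [hVmem, h]
        · rw [hVmem, hVmem, hdec', hred, or_iff_right h, or_iff_right (by omega)]
  refine ⟨V, ?_, fun e x hx => Or.inl (Nat.even_iff.1 hx), fun x y => ?_⟩
  · have := rePred_inLimit hP
    show REPred fun p : ℕ × ℕ => p.2 % 2 = 0 ∨ InLimit P p.1 (dec p.2)
    fun_prop
  · unfold OneOneEquiv
    rw [hle, hle]
    constructor
    · intro hxy
      obtain ⟨a, ha⟩ := (hSP x y).1 hxy
      obtain ⟨k, rfl, rfl, rfl⟩ := exists_req x y a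
      exact ⟨manyOneReducible_of_infinite hP ha (Or.inl ⟨rfl, rfl⟩),
        manyOneReducible_of_infinite hP ha (Or.inr ⟨rfl, rfl⟩)⟩
    · intro hred
      by_contra hxy
      exact not_manyOneReducible hS hPS hxy hred.1

/-! ### Myhill's isomorphism theorem -/

namespace Myhill

/-- A finite list of pairs is a partial isomorphism of the predicates `p` and `q` if it is a
bijection between finite sets that maps `p` to `q`. -/
def IsPartialIso (p q : ℕ → Prop) (l : List (ℕ × ℕ)) : Prop :=
  (∀ x ∈ l, ∀ y ∈ l, x.1 = y.1 ↔ x.2 = y.2) ∧ ∀ x ∈ l, p x.1 ↔ q x.2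

/-- The first component of a pair in `l` with second component `b`, or `a` if there is none. -/
def preimageD (l : List (ℕ × ℕ)) (b a : ℕ) : ℕ :=
  (((l.filter fun x => x.2 = b)[0]?).bind fun x => some x.1).getD a

/-- The `n`-th term of the sequence that starts with `a` and in which `x` is followed by the
`l`-preimage of `f x`, if there is one. -/
def chase (f : ℕ → ℕ) (l : List (ℕ × ℕ)) (a n : ℕ) : ℕ :=
  Nat.rec a (fun _ x => preimageD l (f x) x) n

/-- Extension of the partial isomorphism `l` to the argument `a`. -/
def extend (f : ℕ → ℕ) (l : List (ℕ × ℕ)) (a : ℕ) : List (ℕ × ℕ) :=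
  if ∃ x ∈ l, x.1 = a then l else (a, f (chase f l a l.length)) :: l

/-- The converse of a finite relation. -/
def converse (l : List (ℕ × ℕ)) : List (ℕ × ℕ) := l.map fun x => (x.2, x.1)

/-- The partial isomorphism after `n` steps back and forth. -/
def approx (f g : ℕ → ℕ) (n : ℕ) : List (ℕ × ℕ) :=
  Nat.rec [] (fun n l => converse (extend g (converse (extend f l n)) n)) n

theorem computable_preimageD {α : Type*} [Primcodable α] {l : α → List (ℕ × ℕ)} {a b : α → ℕ}
    (hl : Computable l) (hb : Computable b) (ha : Computable a) :
    Computable fun x => preimageD (l x) (b x) (a x) := by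
  unfold preimageD; fun_prop

theorem computable_converse {α : Type*} [Primcodable α] {l : α → List (ℕ × ℕ)}
    (hl : Computable l) : Computable fun x => converse (l x) := by
  unfold converse; fun_prop

theorem computable_extend {f : ℕ → ℕ} (hf : Computable f) {α : Type*} [Primcodable α]
    {l : α → List (ℕ × ℕ)} {a : α → ℕ} (hl : Computable l) (ha : Computable a) :
    Computable fun x => extend f (l x) (a x) := by
  have h1 : Computable fun x : α × ℕ × ℕ => preimageD (l x.1) (f x.2.2) x.2.2 :=
    computable_preimageD (by fun_prop) (by fun_prop) (by fun_prop)
  unfold extend chase; fun_prop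

theorem computable_approx {f g : ℕ → ℕ} (hf : Computable f) (hg : Computable g) :
    Computable (approx f g) := by
  have h2 : Computable fun x : ℕ × ℕ × List (ℕ × ℕ) =>
      converse (extend g (converse (extend f x.2.2 x.2.1)) x.2.1) :=
    computable_converse (computable_extend hg (computable_converse
      (computable_extend hf (by fun_prop) (by fun_prop))) (by fun_prop))
  unfold approx; fun_prop

theorem preimageD_mem {l : List (ℕ × ℕ)} {b : ℕ} (h : ∃ x ∈ l, x.2 = b) (a : ℕ) :
    (preimageD l b a, b) ∈ l := by
  obtain ⟨y, hy, hyb⟩ := h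
  have hmem : y ∈ l.filter fun x => x.2 = b := by simp [hy, hyb]
  obtain ⟨z, m, hz⟩ := List.exists_cons_of_ne_nil (List.ne_nil_of_mem hmem)
  have hzl : z ∈ l.filter fun x => x.2 = b := by rw [hz]; simp
  simp only [List.mem_filter, decide_eq_true_eq] at hzl
  have : preimageD l b a = z.1 := by simp [preimageD, hz]
  rw [this, ← hzl.2]
  exact hzl.1

theorem preimageD_eq {l : List (ℕ × ℕ)} {b : ℕ} (h : ¬ ∃ x ∈ l, x.2 = b) (a : ℕ) :
    preimageD l b a = a := by
  have : l.filter (fun x => x.2 = b) = [] := by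
    rw [List.filter_eq_nil_iff]
    intro x hx
    simpa using fun hb => h ⟨x, hx, hb⟩
  simp [preimageD, this]

variable {p q : ℕ → Prop} {f g : ℕ → ℕ} {l : List (ℕ × ℕ)}

theorem IsPartialIso.converse (h : IsPartialIso p q l) : IsPartialIso q p (converse l) := by
  simp only [IsPartialIso, Myhill.converse, List.mem_map, forall_exists_index, and_imp,
    forall_apply_eq_imp_iff₂]
  exact ⟨fun x hx y hy => (h.1 x hx y hy).symm, fun x hx => (h.2 x hx).symm⟩

/-- The sequence of preimages leaves the domain of definition before the pairs of `l` are used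
up. -/
theorem not_mem_chase (hl : IsPartialIso p q l) (hf : Function.Injective f) {a : ℕ}
    (ha : ¬ ∃ x ∈ l, x.1 = a) : ¬ ∃ x ∈ l, x.2 = f (chase f l a l.length) := by
  intro hlast
  have hsucc : ∀ n, chase f l a (n + 1) = preimageD l (f (chase f l a n)) (chase f l a n) :=
    fun n => rfl
  -- A term whose value is not in the range is repeated forever, so all values are in the range, and
  -- `chase` runs through more first components than `l` has.
  have hmem : ∀ n ≤ l.length, ∃ x ∈ l, x.2 = f (chase f l a n) := by
    intro n hn
    by_contra hc
    have : ∀ m ≥ n, chase f l a m = chase f l a n := by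
      intro m hm
      induction m, hm using Nat.le_induction with
      | base => rfl
      | succ m _ ih => rw [hsucc, ih, preimageD_eq hc]
    rw [this _ hn] at hlast
    exact hc hlast
  have hpair : ∀ n ≤ l.length, (chase f l a (n + 1), f (chase f l a n)) ∈ l := fun n hn =>
    preimageD_mem (hmem n hn) _
  have hinj : ∀ i j, i < j → j ≤ l.length + 1 → chase f l a i ≠ chase f l a j := by
    intro i
    induction i with
    | zero =>
      rintro (_ | j) hj hjl h
      · omega
      · exact ha ⟨_, hpair j (by omega), h.symm⟩
    | succ i ih =>
      rintro (_ | j) hj hjl h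
      · omega
      · have h1 := (hl.1 _ (hpair i (by omega)) _ (hpair j (by omega))).1 h
        exact ih j (by omega) (by omega) (hf h1)
  have hcard := Finset.card_le_card_of_injOn (s := Finset.range (l.length + 1))
    (t := (l.map Prod.fst).toFinset) (fun i => chase f l a (i + 1)) ?_ ?_
  · have := (l.map Prod.fst).toFinset_card_le
    rw [List.length_map] at this
    rw [Finset.card_range] at hcard
    omega
  · intro i hi
    have hi' : i < l.length + 1 := by simpa using hi
    simp only [List.coe_toFinset, Set.mem_ofPred_eq, List.mem_map]
    exact ⟨_, hpair i (by omega), rfl⟩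
  · intro i hi j hj h
    have hi' : i < l.length + 1 := by simpa using hi
    have hj' : j < l.length + 1 := by simpa using hj
    rcases lt_trichotomy i j with hij | hij | hij
    · exact absurd h (hinj _ _ (by omega) (by omega))
    · exact hij
    · exact absurd h.symm (hinj _ _ (by omega) (by omega))

theorem iff_chase (hl : IsPartialIso p q l) (hred : ∀ n, p n ↔ q (f n)) (a n : ℕ) :
    p a ↔ p (chase f l a n) := by
  induction n with
  | zero => rfl
  | succ n ih =>
    have hsucc : chase f l a (n + 1) = preimageD l (f (chase f l a n)) (chase f l a n) := rfl
    by_cases h : ∃ x ∈ l, x.2 = f (chase f l a n)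
    · have := hl.2 _ (preimageD_mem h (chase f l a n))
      rw [ih, hred, hsucc, this]
    · rw [hsucc, preimageD_eq h, ih]

theorem IsPartialIso.extend (hl : IsPartialIso p q l) (hf : Function.Injective f)
    (hred : ∀ n, p n ↔ q (f n)) (a : ℕ) : IsPartialIso p q (extend f l a) := by
  unfold Myhill.extend
  split_ifs with ha
  · exact hl
  · have hb := not_mem_chase hl hf ha
    push Not at ha hb
    constructor
    · intro x hx y hy
      rcases List.mem_cons.1 hx with rfl | hx <;> rcases List.mem_cons.1 hy with rfl | hy
      · simp
      · simp [(ha y hy).symm, (hb y hy).symm]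
      · simp [ha x hx, hb x hx]
      · exact hl.1 x hx y hy
    · intro x hx
      rcases List.mem_cons.1 hx with rfl | hx
      · exact (iff_chase hl hred a _).trans (hred _)
      · exact hl.2 x hx

theorem subset_extend (a : ℕ) : l ⊆ extend f l a := by
  unfold extend
  split_ifs
  · exact fun _ h => h
  · exact List.subset_cons_self _ _

theorem exists_mem_extend (a : ℕ) : ∃ b, (a, b) ∈ extend f l a := by
  unfold extend
  split_ifs with h
  · obtain ⟨⟨x, y⟩, hx, rfl⟩ := h
    exact ⟨y, hx⟩
  · exact ⟨_, List.mem_cons_self⟩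

theorem mem_converse {a b : ℕ} : (a, b) ∈ converse l ↔ (b, a) ∈ l := by
  simp [converse]

theorem approx_succ (n : ℕ) :
    approx f g (n + 1) = converse (extend g (converse (extend f (approx f g n) n)) n) := rfl

theorem approx_mono {m n : ℕ} (h : m ≤ n) : approx f g m ⊆ approx f g n := by
  induction n, h using Nat.le_induction with
  | base => exact fun _ h => h
  | succ n _ ih =>
    rintro ⟨a, b⟩ hx
    rw [approx_succ, mem_converse]
    exact subset_extend _ (mem_converse.2 (subset_extend _ (ih hx)))

end Myhill

open Myhill in
/-- Myhill's isomorphism theorem: one-one equivalent predicates are computably isomorphic. -/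
theorem OneOneEquiv.exists_equiv {p q : ℕ → Prop} (h : OneOneEquiv p q) :
    ∃ e : ℕ ≃ ℕ, Computable e ∧ ∀ n, p n ↔ q (e n) := by
  obtain ⟨⟨f, hf, hfi, hpq⟩, ⟨g, hg, hgi, hqp⟩⟩ := h
  have hgood : ∀ n, IsPartialIso p q (approx f g n) := by
    intro n
    induction n with
    | zero => exact ⟨by simp [approx], by simp [approx]⟩
    | succ n ih => exact ((ih.extend hfi hpq n).converse.extend hgi hqp n).converse
  have hdom : ∀ n, ∃ b, (n, b) ∈ approx f g (n + 1) := fun n =>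
    let ⟨b, hb⟩ := exists_mem_extend (f := f) (l := approx f g n) n
    ⟨b, mem_converse.2 (subset_extend _ (mem_converse.2 hb))⟩
  have hran : ∀ n, ∃ a, (a, n) ∈ approx f g (n + 1) := fun n =>
    let ⟨a, ha⟩ := exists_mem_extend (f := g) (l := converse (extend f (approx f g n) n)) n
    ⟨a, mem_converse.2 ha⟩
  have hval : ∀ n, (n, preimageD (converse (approx f g (n + 1))) n 0) ∈ approx f g (n + 1) := by
    intro n
    obtain ⟨b, hb⟩ := hdom n
    exact mem_converse.1 (preimageD_mem ⟨(b, n), mem_converse.2 hb, rfl⟩ 0)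
  choose a ha using hran
  refine ⟨⟨fun n => preimageD (converse (approx f g (n + 1))) n 0, a, fun n => ?_, fun n => ?_⟩,
    ?_, fun n => (hgood _).2 _ (hval n)⟩
  · set b := preimageD (converse (approx f g (n + 1))) n 0
    have h1 := approx_mono (le_max_left (n + 1) (b + 1)) (hval n)
    have h2 := approx_mono (le_max_right (n + 1) (b + 1)) (ha b)
    exact ((hgood _).1 _ h2 _ h1).2 rfl
  · have h1 := approx_mono (le_max_left (n + 1) (a n + 1)) (ha n)
    have h2 := approx_mono (le_max_right (n + 1) (a n + 1)) (hval (a n))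
    exact ((hgood _).1 _ h2 _ h1).1 rfl
  · have := computable_approx hf hg
    exact computable_preimageD (computable_converse (by fun_prop)) (by fun_prop) (by fun_prop)

/-! ### Computable presentations of the linear orders -/

namespace Expansion

variable {V : Set ℕ}

/-- The index of the summand that contains `z`. -/
def block (z : Expansion V) : ℕ := (ofLex z).1

/-- The position of `z` in its summand. -/
def pos (z : Expansion V) : ℚ := (ofLex z).2.1

/-- The element of block `x` at position `q`. -/
def mk (x : ℕ) (q : ℚ) (h : 0 ≤ q ∧ q < 1 ∧ (q = 0 ∨ x ∈ V)) : Expansion V := toLex ⟨x, ⟨q, h⟩⟩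

@[simp]
theorem block_mk {x : ℕ} {q : ℚ} (h : 0 ≤ q ∧ q < 1 ∧ (q = 0 ∨ x ∈ V)) : (mk x q h).block = x := rfl

@[simp]
theorem pos_mk {x : ℕ} {q : ℚ} (h : 0 ≤ q ∧ q < 1 ∧ (q = 0 ∨ x ∈ V)) : (mk x q h).pos = q := rfl

theorem pos_spec (z : Expansion V) : 0 ≤ z.pos ∧ z.pos < 1 ∧ (z.pos = 0 ∨ z.block ∈ V) :=
  (ofLex z).2.2

@[simp]
theorem block_min (x : ℕ) : (Expansion.min V x).block = x := rfl

@[simp]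
theorem pos_min (x : ℕ) : (Expansion.min V x).pos = 0 := rfl

theorem ext {z w : Expansion V} (h1 : z.block = w.block) (h2 : z.pos = w.pos) : z = w := by
  obtain ⟨x, q⟩ := z
  obtain ⟨y, r⟩ := w
  obtain rfl : x = y := h1
  obtain rfl : q = r := Subtype.ext h2
  rfl

theorem le_iff {z w : Expansion V} :
    z ≤ w ↔ z.block < w.block ∨ z.block = w.block ∧ z.pos ≤ w.pos := by
  rw [Sigma.Lex.le_def]
  refine or_congr Iff.rfl ⟨?_, ?_⟩
  · rintro ⟨h, h'⟩
    refine ⟨h, ?_⟩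
    obtain ⟨x, q⟩ := z
    obtain ⟨y, r⟩ := w
    obtain rfl : x = y := h
    exact h'
  · rintro ⟨h, h'⟩
    refine ⟨h, ?_⟩
    obtain ⟨x, q⟩ := z
    obtain ⟨y, r⟩ := w
    obtain rfl : x = y := h
    exact h'

theorem lt_iff {z w : Expansion V} :
    z < w ↔ z.block < w.block ∨ z.block = w.block ∧ z.pos < w.pos := by
  rw [← not_le, le_iff]
  rcases lt_trichotomy z.block w.block with h | h | h
  · simp [h, h.not_gt, h.ne']
  · simp [h]
  · simp [h, h.not_gt, h.ne']

theorem bot_eq_min : (⊥ : Expansion V) = Expansion.min V 0 := rfl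

end Expansion

/-- A system of names for the elements of the orders `Expansion (V e)` together with computable
functions that compute, from `e` and the name of an element, its block and the numerator and
denominator of its position. -/
structure Presentation (V : ℕ → Set ℕ) where
  name : ∀ e, Expansion (V e) ≃ ℕ
  block : ℕ × ℕ → ℕ
  num : ℕ × ℕ → ℕ
  den : ℕ × ℕ → ℕ
  computable_block : Computable block
  computable_num : Computable num
  computable_den : Computable den
  den_pos : ∀ x, 0 < den x
  block_name : ∀ e n, ((name e).symm n).block = block (e, n)
  pos_name : ∀ e n, ((name e).symm n).pos = num (e, n) / den (e, n)
  name_min : ∀ e x, name e (Expansion.min (V e) x) = 2 * x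

namespace Presentation

/-- `n = ⟨x, a, b, s⟩` codes the point of block `x` at the position `a / b`, in lowest terms,
where `s` is the stage at which `x` enters the `e`-th set. -/
def IsCode (R : (ℕ × ℕ) × ℕ → Prop) (e n : ℕ) : Prop :=
  R ((e, n.unpair.1), n.unpair.2.unpair.2.unpair.2) ∧
  (∀ s < n.unpair.2.unpair.2.unpair.2, ¬ R ((e, n.unpair.1), s)) ∧
  0 < n.unpair.2.unpair.1 ∧ n.unpair.2.unpair.1 < n.unpair.2.unpair.2.unpair.1 ∧
  ∀ d ≤ n.unpair.2.unpair.2.unpair.1, n.unpair.2.unpair.1 % d = 0 →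
    n.unpair.2.unpair.2.unpair.1 % d = 0 → d = 1

theorem computablePred_isCode {R : (ℕ × ℕ) × ℕ → Prop} (hR : ComputablePred R) :
    ComputablePred fun x : ℕ × ℕ => IsCode R x.1 x.2 := by
  unfold IsCode; fun_prop

theorem IsCode.eq {R : (ℕ × ℕ) × ℕ → Prop} {e m n : ℕ} (hm : IsCode R e m) (hn : IsCode R e n)
    (h1 : m.unpair.1 = n.unpair.1) (h2 : m.unpair.2.unpair.1 = n.unpair.2.unpair.1)
    (h3 : m.unpair.2.unpair.2.unpair.1 = n.unpair.2.unpair.2.unpair.1) : m = n := by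
  have h4 : m.unpair.2.unpair.2.unpair.2 = n.unpair.2.unpair.2.unpair.2 := by
    rcases lt_trichotomy m.unpair.2.unpair.2.unpair.2 n.unpair.2.unpair.2.unpair.2 with h | h | h
    · exact absurd (h1 ▸ hm.1) (hn.2.1 _ h)
    · exact h
    · exact absurd (h1 ▸ hn.1) (hm.2.1 _ h)
  rw [← Nat.pair_unpair m, ← Nat.pair_unpair m.unpair.2, ← Nat.pair_unpair m.unpair.2.unpair.2,
    h1, h2, h3, h4, Nat.pair_unpair, Nat.pair_unpair, Nat.pair_unpair]

/-- The condition in `IsCode` that a fraction is in lowest terms, in a form that is visibly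
decidable. -/
theorem coprime_iff {a b : ℕ} (hb : 0 < b) :
    (∀ d ≤ b, a % d = 0 → b % d = 0 → d = 1) ↔ a.Coprime b := by
  constructor
  · intro h
    exact h _ (Nat.gcd_le_right a hb) (Nat.mod_eq_zero_of_dvd (Nat.gcd_dvd_left a b))
      (Nat.mod_eq_zero_of_dvd (Nat.gcd_dvd_right a b))
  · intro h d _ h1 h2
    exact Nat.eq_one_of_dvd_coprimes h (Nat.dvd_of_mod_eq_zero h1) (Nat.dvd_of_mod_eq_zero h2)

open Classical in
/-- The enumeration in increasing order of the members of uniformly computable infinite sets is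
uniformly computable. -/
theorem computable_nth {p : ℕ × ℕ → Prop} (hp : ComputablePred p)
    (hinf : ∀ e, {n | p (e, n)}.Infinite) :
    Computable fun x : ℕ × ℕ => Nat.nth (fun n => p (x.1, n)) x.2 := by
  have hcount : Computable fun x : ℕ × ℕ => Nat.count (fun n => p (x.1, n)) x.2 := by
    have : Computable fun x : ℕ × ℕ =>
        ((List.range x.2).filter fun n => decide (p (x.1, n))).length := by fun_prop
    refine this.of_eq fun x => ?_
    rw [Nat.count_eq_card_filter_range]
    rfl
  refine Computable.of_graph ?_
  have : ComputablePred fun x : (ℕ × ℕ) × ℕ =>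
      p (x.1.1, x.2) ∧ Nat.count (fun n => p (x.1.1, n)) x.2 = x.1.2 := by
    have := hcount.comp (f := fun x : ℕ × ℕ => Nat.count (fun n => p (x.1, n)) x.2)
      (g := fun x : (ℕ × ℕ) × ℕ => (x.1.1, x.2)) (by fun_prop)
    fun_prop
  refine this.of_eq fun x => ⟨?_, ?_⟩
  · rintro ⟨h1, h2⟩
    rw [← h2]
    exact Nat.nth_count (p := fun n => p (x.1.1, n)) h1
  · intro h
    rw [← h]
    exact ⟨Nat.nth_mem_of_infinite (p := fun n => p (x.1.1, n)) (hinf _) _,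
      Nat.count_nth_of_infinite (p := fun n => p (x.1.1, n)) (hinf _) _⟩

/-- The point of a block at the position `0` gets the name `2 * x`. The odd names are given to the
remaining points, which are listed with the help of their codes `IsCode`. -/
theorem nonempty {V : ℕ → Set ℕ} (hV : REPred fun p : ℕ × ℕ => p.2 ∈ V p.1)
    (heven : ∀ e x, Even x → x ∈ V e) : Nonempty (Presentation V) := by
  classical
  obtain ⟨R, hR, hVR⟩ := REPred.iff_exists_computablePred.1 hV
  have hstage : ∀ {e x}, x ∈ V e → ∃ s, R ((e, x), s) ∧ ∀ t < s, ¬ R ((e, x), t) :=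
    fun {e x} h => ⟨Nat.find ((hVR (e, x)).1 h), Nat.find_spec ((hVR (e, x)).1 h),
      fun t ht => Nat.find_min ((hVR (e, x)).1 h) ht⟩
  have hinf : ∀ e, {n | IsCode R e n}.Infinite := by
    intro e
    choose s hs using fun x : ℕ => hstage (heven e (2 * x) (even_two_mul x))
    refine Set.infinite_of_injective_forall_mem
      (f := fun x => Nat.pair (2 * x) (Nat.pair 1 (Nat.pair 2 (s x)))) (fun x y h => ?_) fun x => ?_
    · have := (Nat.pair_eq_pair.1 h).1
      omega
    · simp only [IsCode, Set.mem_ofPred_eq, Nat.unpair_pair]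
      refine ⟨(hs x).1, (hs x).2, by omega, by omega, ?_⟩
      rw [coprime_iff (by omega)]
      decide
  let nth : ℕ × ℕ → ℕ := fun x => Nat.nth (IsCode R x.1) (x.2 / 2)
  have hnth : Computable nth :=
    (computable_nth (p := fun x => IsCode R x.1 x.2) (computablePred_isCode hR) hinf).comp
      (g := fun x : ℕ × ℕ => (x.1, x.2 / 2)) (by fun_prop)
  have hmem : ∀ x, IsCode R x.1 (nth x) := fun x => Nat.nth_mem_of_infinite (hinf x.1) _
  let bl : ℕ × ℕ → ℕ := fun x => if x.2 % 2 = 0 then x.2 / 2 else (nth x).unpair.1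
  let nu : ℕ × ℕ → ℕ := fun x => if x.2 % 2 = 0 then 0 else (nth x).unpair.2.unpair.1
  let de : ℕ × ℕ → ℕ := fun x => if x.2 % 2 = 0 then 1 else (nth x).unpair.2.unpair.2.unpair.1
  have hde : ∀ x, 0 < de x := by
    intro x
    dsimp only [de]
    split_ifs
    · exact one_pos
    · exact (hmem x).2.2.1.trans (hmem x).2.2.2.1
  have hlt : ∀ x, nu x < de x := by
    intro x
    dsimp only [nu, de]
    split_ifs
    · exact one_pos
    · exact (hmem x).2.2.2.1
  have hcop : ∀ x, (nu x).Coprime (de x) := by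
    intro x
    have h1 := hde x
    dsimp only [nu, de] at h1 ⊢
    split_ifs at h1 ⊢
    · exact Nat.coprime_zero_left _ |>.2 rfl
    · exact (coprime_iff h1).1 (hmem x).2.2.2.2
  have hV' : ∀ x, (nu x = 0 ↔ x.2 % 2 = 0) ∧ (x.2 % 2 ≠ 0 → bl x ∈ V x.1) := by
    intro x
    dsimp only [nu, bl]
    split_ifs with h
    · simp [h]
    · simp only [h, iff_false, not_false_eq_true, ne_eq, forall_const]
      exact ⟨(hmem x).2.2.1.ne', (hVR _).2 ⟨_, (hmem x).1⟩⟩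
  have hok : ∀ x, 0 ≤ (nu x / de x : ℚ) ∧ (nu x / de x : ℚ) < 1 ∧
      ((nu x / de x : ℚ) = 0 ∨ bl x ∈ V x.1) := by
    intro x
    have := hde x
    refine ⟨by positivity, ?_, ?_⟩
    · rw [div_lt_one (by exact_mod_cast this)]
      exact_mod_cast hlt x
    · by_cases h : x.2 % 2 = 0
      · left
        rw [((hV' x).1).2 h]
        simp
      · exact Or.inr ((hV' x).2 h)
  let el : ∀ e, ℕ → Expansion (V e) := fun e n => Expansion.mk (bl (e, n)) _ (hok (e, n))
  have hrat : ∀ {x y}, (nu x / de x : ℚ) = nu y / de y → nu x = nu y ∧ de x = de y := by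
    intro x y h
    have h1 := Rat.div_int_inj (a := nu x) (b := de x) (c := nu y) (d := de y)
      (by exact_mod_cast hde x) (by exact_mod_cast hde y) (by simpa using hcop x)
      (by simpa using hcop y) (by simpa using h)
    exact_mod_cast h1
  have hbij : ∀ e, Function.Bijective (el e) := by
    intro e
    constructor
    · intro m n h
      have h1 : bl (e, m) = bl (e, n) := congrArg Expansion.block h
      have h2 := hrat (congrArg Expansion.pos h)
      by_cases hm : m % 2 = 0
      · have hn : n % 2 = 0 := (hV' (e, n)).1.1 (h2.1 ▸ (hV' (e, m)).1.2 hm)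
        simp only [bl, hm, hn, if_true] at h1
        omega
      · have hn : n % 2 ≠ 0 := fun hn => hm ((hV' (e, m)).1.1 (h2.1 ▸ (hV' (e, n)).1.2 hn))
        have h3 := hmem (e, m)
        have h4 := hmem (e, n)
        simp only [bl, nu, de, hm, hn, if_false] at h1 h2
        have h5 : nth (e, m) = nth (e, n) := h3.eq h4 h1 h2.1 h2.2
        have := Nat.nth_injective (hinf e) h5
        omega
    · intro z
      by_cases h0 : z.pos = 0
      · refine ⟨2 * z.block, Expansion.ext ?_ ?_⟩
        · simp [el, bl]
        · simp [el, nu, h0]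
      · obtain ⟨hz0, hz1, hzV⟩ := z.pos_spec
        obtain ⟨s, hs, hmin⟩ := hstage (hzV.resolve_left h0)
        have hnum : (z.pos.num.toNat : ℤ) = z.pos.num := Int.toNat_of_nonneg (Rat.num_nonneg.2 hz0)
        set n := Nat.pair z.block (Nat.pair z.pos.num.toNat (Nat.pair z.pos.den s)) with hn
        have hcode : IsCode R e n := by
          simp only [IsCode, hn, Nat.unpair_pair]
          refine ⟨hs, hmin, ?_, ?_, ?_⟩
          · have : 0 < z.pos.num := Rat.num_pos.2 (lt_of_le_of_ne hz0 (Ne.symm h0))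
            omega
          · have : z.pos.num < z.pos.den := Rat.num_lt_denom_iff.2 hz1
            omega
          · rw [coprime_iff z.pos.den_pos]
            have := z.pos.reduced
            rwa [← hnum, Int.natAbs_natCast] at this
        have h1 : nth (e, 2 * Nat.count (IsCode R e) n + 1) = n := by
          have : (2 * Nat.count (IsCode R e) n + 1) / 2 = Nat.count (IsCode R e) n := by omega
          simp only [nth, this]
          exact Nat.nth_count hcode
        have h2 : (2 * Nat.count (IsCode R e) n + 1) % 2 ≠ 0 := by omega
        refine ⟨2 * Nat.count (IsCode R e) n + 1, Expansion.ext ?_ ?_⟩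
        · simp only [el, bl, h1, Expansion.block_mk, h2, if_false]
          simp [hn]
        · simp only [el, nu, de, h1, Expansion.pos_mk, h2, if_false]
          simp only [hn, Nat.unpair_pair]
          rw [← Int.cast_natCast, hnum]
          exact Rat.num_div_den _
  exact ⟨{
    name := fun e => (Equiv.ofBijective _ (hbij e)).symm
    block := bl
    num := nu
    den := de
    computable_block := by fun_prop
    computable_num := by fun_prop
    computable_den := by fun_prop
    den_pos := hde
    block_name := fun e n => rfl
    pos_name := fun e n => rfl
    name_min := fun e x => by
      rw [Equiv.symm_apply_eq]
      refine Expansion.ext ?_ ?_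
      · simp [el, bl]
      · simp [el, nu] }⟩

variable {V : ℕ → Set ℕ} (A : Presentation V)

theorem le_iff (e m n : ℕ) : (A.name e).symm m ≤ (A.name e).symm n ↔
    A.block (e, m) < A.block (e, n) ∨ A.block (e, m) = A.block (e, n) ∧
      A.num (e, m) * A.den (e, n) ≤ A.num (e, n) * A.den (e, m) := by
  have h1 : (0 : ℚ) < A.den (e, m) := by exact_mod_cast A.den_pos _
  have h2 : (0 : ℚ) < A.den (e, n) := by exact_mod_cast A.den_pos _
  rw [Expansion.le_iff, A.block_name, A.block_name, A.pos_name, A.pos_name, div_le_div_iff₀ h1 h2]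
  norm_cast

theorem pos_eq_iff (e m i n : ℕ) : ((A.name e).symm m).pos = ((A.name i).symm n).pos ↔
      A.num (e, m) * A.den (i, n) = A.num (i, n) * A.den (e, m) := by
  have h1 : (A.den (e, m) : ℚ) ≠ 0 := by exact_mod_cast (A.den_pos _).ne'
  have h2 : (A.den (i, n) : ℚ) ≠ 0 := by exact_mod_cast (A.den_pos _).ne'
  rw [A.pos_name, A.pos_name, div_eq_div_iff h1 h2]
  norm_cast

theorem computablePred_le : ComputablePred fun x : ℕ × ℕ × ℕ =>
    (A.name x.1).symm x.2.1 ≤ (A.name x.1).symm x.2.2 := by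
  have h1 := A.computable_block
  have h2 := A.computable_num
  have h3 := A.computable_den
  simp only [A.le_iff]
  fun_prop

end Presentation

/-! ### Computable isomorphism of indexed Boolean algebras -/

open Nat.Partrec (Code)

theorem rePred_mem_phi {α : Type*} [Primcodable α] {e n m : α → ℕ} (he : Computable e)
    (hn : Computable n) (hm : Computable m) : REPred fun a => m a ∈ phi (e a) (n a) := by
  have : REPred fun a => ∃ s,
      Code.evaln s (Denumerable.ofNat Code (e a)) (n a) = some (m a) := by fun_prop
  exact this.of_eq fun a => Code.evaln_complete.symm

attribute [fun_prop] rePred_mem_phi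

theorem exists_phi {p : ℕ →. ℕ} (hp : Nat.Partrec p) : ∃ a, phi a = p := by
  obtain ⟨c, hc⟩ := Code.exists_code.1 hp
  exact ⟨Encodable.encode c, by simp [phi, hc]⟩

theorem partrec_phi (a : ℕ) : Nat.Partrec (phi a) := Code.exists_code.2 ⟨_, rfl⟩

namespace CodedBA

theorem HasIndex.mem_range_iff {A : CodedBA} {e : ℕ} (hA : A.HasIndex e) (n : ℕ) :
    n ∈ Set.range A.code ↔ 1 ∈ phi e (Nat.pair 0 n) := by
  by_cases h : n ∈ Set.range A.code
  · simp [h, hA.mem_dom n h]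
  · simp [h, hA.not_mem_dom n h]

theorem CompIso.trans {A B C : CodedBA} (h1 : A.CompIso B) (h2 : B.CompIso C) : A.CompIso C := by
  obtain ⟨f, p, hp, hf⟩ := h1
  obtain ⟨g, q, hq, hg⟩ := h2
  refine ⟨f.trans g, fun n => p n >>= q, hq.comp hp, fun x => ?_⟩
  show (p _).bind q = _
  rw [hf]
  exact (Part.bind_some _ _).trans (hg _)

/-- The inverse of a computable isomorphism is computed by searching the domain for a preimage. -/
theorem CompIso.symm {A B : CodedBA} {e : ℕ} (hA : A.HasIndex e) (h : A.CompIso B) :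
    B.CompIso A := by
  obtain ⟨f, p, hp, hf⟩ := h
  obtain ⟨a, rfl⟩ := exists_phi hp
  obtain ⟨q, hq, hsel⟩ := REPred.exists_selector
    (G := fun m n => 1 ∈ phi e (Nat.pair 0 n) ∧ m ∈ phi a n) (by fun_prop)
  refine ⟨f.symm, q, hq, fun y => ?_⟩
  obtain ⟨n, hn, hdom, hval⟩ := hsel (B.code y) ⟨A.code (f.symm y),
    (hA.mem_range_iff _).1 ⟨_, rfl⟩, by simp [hf]⟩
  obtain ⟨x, rfl⟩ := (hA.mem_range_iff _).2 hdom
  rw [hf, Part.mem_some_iff] at hval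
  rw [show f.symm y = x by rw [B.code_injective hval, f.symm_apply_apply]]
  exact Part.eq_some_iff.2 hn

/-- A bijection of Boolean algebras that preserves joins is an order isomorphism. -/
noncomputable def isoOfSup {A B : Type} [BooleanAlgebra A] [BooleanAlgebra B] (f : A → B)
    (hf : Function.Bijective f) (hsup : ∀ x y, f (x ⊔ y) = f x ⊔ f y) : A ≃o B where
  toEquiv := Equiv.ofBijective f hf
  map_rel_iff' {x y} := by
    show f x ≤ f y ↔ x ≤ y
    rw [← sup_eq_right, ← hsup, hf.1.eq_iff, sup_eq_right]

/-- An index determines the domain and the operations, hence the algebra up to an isomorphism that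
is the identity on names. -/
theorem HasIndex.compIso {A B : CodedBA} {e : ℕ} (hA : A.HasIndex e) (hB : B.HasIndex e) :
    A.CompIso B := by
  have hrange : ∀ n, n ∈ Set.range A.code ↔ n ∈ Set.range B.code := fun n =>
    (hA.mem_range_iff n).trans (hB.mem_range_iff n).symm
  choose f hf using fun x => (hrange (A.code x)).1 ⟨x, rfl⟩
  refine ⟨isoOfSup f ⟨fun x y h => ?_, fun y => ?_⟩ fun x y => ?_, fun n => Part.some n,
    Nat.Partrec.some, fun x => congrArg Part.some (hf x).symm⟩
  · apply A.code_injective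
    rw [← hf x, ← hf y, h]
  · obtain ⟨x, hx⟩ := (hrange (B.code y)).2 ⟨y, rfl⟩
    exact ⟨x, B.code_injective ((hf x).trans hx)⟩
  · apply B.code_injective
    have h1 := hA.sup x y
    rw [← hf x, ← hf y, hB.sup, Part.some_inj] at h1
    rw [hf, h1]

end CodedBA

theorem compIsoBA_iff {A B : CodedBA} {e i : ℕ} (hA : A.HasIndex e) (hB : B.HasIndex i) :
    compIsoBA e i ↔ A.CompIso B := by
  constructor
  · rintro ⟨A', B', hA', hB', h⟩
    exact (hA.compIso hA').trans (h.trans (hB'.compIso hB))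
  · exact fun h => ⟨A, B, hA, hB, h⟩

/-- Terms of the language of Boolean algebras in three variables. -/
inductive BoolTerm
  | x | y | z | bot | top
  | sup (s t : BoolTerm)
  | inf (s t : BoolTerm)
  | compl (s : BoolTerm)

namespace BoolTerm

/-- The value of a term under an assignment. -/
def eval {α : Type} [Max α] [Min α] [Compl α] [Bot α] [Top α] (v : α × α × α) : BoolTerm → α
  | x => v.1
  | y => v.2.1
  | z => v.2.2
  | bot => ⊥
  | top => ⊤
  | sup s t => s.eval v ⊔ t.eval v
  | inf s t => s.eval v ⊓ t.eval v
  | compl s => (s.eval v)ᶜ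

/-- `m` is the value of a term when the operations are computed by `phi e`. -/
def Value (e : ℕ) (v : ℕ × ℕ × ℕ) : BoolTerm → ℕ → Prop
  | x, m => m = v.1
  | y, m => m = v.2.1
  | z, m => m = v.2.2
  | bot, m => m ∈ phi e (Nat.pair 4 0)
  | top, m => m ∈ phi e (Nat.pair 5 0)
  | sup s t, m => ∃ a b, (s.Value e v a ∧ t.Value e v b) ∧ m ∈ phi e (Nat.pair 1 (Nat.pair a b))
  | inf s t, m => ∃ a b, (s.Value e v a ∧ t.Value e v b) ∧ m ∈ phi e (Nat.pair 2 (Nat.pair a b))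
  | compl s, m => ∃ a, s.Value e v a ∧ m ∈ phi e (Nat.pair 3 a)

theorem rePred_value {α : Type*} [Primcodable α] {e m : α → ℕ} {v : α → ℕ × ℕ × ℕ}
    (he : Computable e) (hv : Computable v) (hm : Computable m) (t : BoolTerm) :
    REPred fun a => t.Value (e a) (v a) (m a) := by
  suffices h : REPred fun a : ℕ × (ℕ × ℕ × ℕ) × ℕ => t.Value a.1 a.2.1 a.2.2 from
    h.comp_computable (he.pair (hv.pair hm))
  induction t with
  | x => simp only [Value]; fun_prop
  | y => simp only [Value]; fun_prop
  | z => simp only [Value]; fun_prop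
  | bot => simp only [Value]; fun_prop
  | top => simp only [Value]; fun_prop
  | sup s t hs ht =>
    have h1 : REPred fun a : ((ℕ × (ℕ × ℕ × ℕ) × ℕ) × ℕ) × ℕ => s.Value a.1.1.1 a.1.1.2.1 a.1.2 :=
      hs.comp_computable (f := fun a : ((ℕ × (ℕ × ℕ × ℕ) × ℕ) × ℕ) × ℕ =>
        (a.1.1.1, a.1.1.2.1, a.1.2)) (by fun_prop)
    have h2 : REPred fun a : ((ℕ × (ℕ × ℕ × ℕ) × ℕ) × ℕ) × ℕ => t.Value a.1.1.1 a.1.1.2.1 a.2 :=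
      ht.comp_computable (f := fun a : ((ℕ × (ℕ × ℕ × ℕ) × ℕ) × ℕ) × ℕ =>
        (a.1.1.1, a.1.1.2.1, a.2)) (by fun_prop)
    have h3 : REPred fun a : ((ℕ × (ℕ × ℕ × ℕ) × ℕ) × ℕ) × ℕ =>
        a.1.1.2.2 ∈ phi a.1.1.1 (Nat.pair 1 (Nat.pair a.1.2 a.2)) :=
      rePred_mem_phi (by fun_prop) (by fun_prop) (by fun_prop)
    exact REPred.exists_comp (REPred.exists_comp ((h1.and_comp h2).and_comp h3))
  | inf s t hs ht =>
    have h1 : REPred fun a : ((ℕ × (ℕ × ℕ × ℕ) × ℕ) × ℕ) × ℕ => s.Value a.1.1.1 a.1.1.2.1 a.1.2 :=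
      hs.comp_computable (f := fun a : ((ℕ × (ℕ × ℕ × ℕ) × ℕ) × ℕ) × ℕ =>
        (a.1.1.1, a.1.1.2.1, a.1.2)) (by fun_prop)
    have h2 : REPred fun a : ((ℕ × (ℕ × ℕ × ℕ) × ℕ) × ℕ) × ℕ => t.Value a.1.1.1 a.1.1.2.1 a.2 :=
      ht.comp_computable (f := fun a : ((ℕ × (ℕ × ℕ × ℕ) × ℕ) × ℕ) × ℕ =>
        (a.1.1.1, a.1.1.2.1, a.2)) (by fun_prop)
    have h3 : REPred fun a : ((ℕ × (ℕ × ℕ × ℕ) × ℕ) × ℕ) × ℕ =>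
        a.1.1.2.2 ∈ phi a.1.1.1 (Nat.pair 2 (Nat.pair a.1.2 a.2)) :=
      rePred_mem_phi (by fun_prop) (by fun_prop) (by fun_prop)
    exact REPred.exists_comp (REPred.exists_comp ((h1.and_comp h2).and_comp h3))
  | compl s hs =>
    have h1 : REPred fun a : (ℕ × (ℕ × ℕ × ℕ) × ℕ) × ℕ => s.Value a.1.1 a.1.2.1 a.2 :=
      hs.comp_computable (f := fun a : (ℕ × (ℕ × ℕ × ℕ) × ℕ) × ℕ =>
        (a.1.1, a.1.2.1, a.2)) (by fun_prop)
    have h2 : REPred fun a : (ℕ × (ℕ × ℕ × ℕ) × ℕ) × ℕ => a.1.2.2 ∈ phi a.1.1 (Nat.pair 3 a.2) :=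
      rePred_mem_phi (by fun_prop) (by fun_prop) (by fun_prop)
    exact REPred.exists_comp (h1.and_comp h2)

/-- `phi e` computes the operations of `α` on the codes of elements. -/
structure Computes {α : Type} [Max α] [Min α] [Compl α] [Bot α] [Top α] (code : α → ℕ) (e : ℕ) :
    Prop where
  sup : ∀ x y, phi e (Nat.pair 1 (Nat.pair (code x) (code y))) = Part.some (code (x ⊔ y))
  inf : ∀ x y, phi e (Nat.pair 2 (Nat.pair (code x) (code y))) = Part.some (code (x ⊓ y))
  compl : ∀ x, phi e (Nat.pair 3 (code x)) = Part.some (code xᶜ)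
  bot : phi e (Nat.pair 4 0) = Part.some (code ⊥)
  top : phi e (Nat.pair 5 0) = Part.some (code ⊤)

/-- Semantic and computed values of terms agree. -/
theorem Computes.value_iff {α : Type} [Max α] [Min α] [Compl α] [Bot α] [Top α] {code : α → ℕ}
    {e : ℕ} (h : Computes code e) (v : α × α × α) (t : BoolTerm) (m : ℕ) :
    t.Value e (code v.1, code v.2.1, code v.2.2) m ↔ m = code (t.eval v) := by
  induction t generalizing m with
  | x => rfl
  | y => rfl
  | z => rfl
  | bot => simp [Value, eval, h.bot]
  | top => simp [Value, eval, h.top]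
  | sup s t hs ht => simp [Value, eval, hs, ht, h.sup]
  | inf s t hs ht => simp [Value, eval, hs, ht, h.inf]
  | compl s hs => simp [Value, eval, hs, h.compl]

/-- Equational axioms of Boolean algebras. The order is the one that is defined by joins. -/
def equations : List (BoolTerm × BoolTerm) :=
  [(sup x y, sup y x), (sup (sup x y) z, sup x (sup y z)), (inf x y, inf y x),
    (inf (inf x y) z, inf x (inf y z)), (sup x (inf x y), x), (inf x (sup x y), x),
    (inf (sup x y) (sup x z), sup x (inf y z)), (inf x (compl x), bot), (sup x (compl x), top),
    (sup x top, top), (sup bot x, x)]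

theorem eval_eq_of_mem_equations {α : Type} [BooleanAlgebra α] {s : BoolTerm × BoolTerm}
    (hs : s ∈ equations) (v : α × α × α) : s.1.eval v = s.2.eval v := by
  simp only [equations, List.mem_cons, List.not_mem_nil, or_false] at hs
  rcases hs with rfl | rfl | rfl | rfl | rfl | rfl | rfl | rfl | rfl | rfl | rfl <;>
    simp [eval, sup_comm, inf_comm, sup_inf_left, sup_left_comm,
      inf_left_comm]

/-- A structure that satisfies the equational axioms is a Boolean algebra. -/
abbrev booleanAlgebra {α : Type} [Max α] [Min α] [Compl α] [Bot α] [Top α]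
    (h : ∀ s ∈ equations, ∀ v : α × α × α, s.1.eval v = s.2.eval v) : BooleanAlgebra α :=
  let L : Lattice α := Lattice.mk'
    (fun a b => h (sup x y, sup y x) (by simp [equations]) (a, b, b))
    (fun a b c => h (sup (sup x y) z, sup x (sup y z)) (by simp [equations]) (a, b, c))
    (fun a b => h (inf x y, inf y x) (by simp [equations]) (a, b, b))
    (fun a b c => h (inf (inf x y) z, inf x (inf y z)) (by simp [equations]) (a, b, c))
    (fun a b => h (sup x (inf x y), x) (by simp [equations]) (a, b, b))
    (fun a b => h (inf x (sup x y), x) (by simp [equations]) (a, b, b))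
  { L with
    le_sup_inf := fun a b c =>
      (h (inf (sup x y) (sup x z), sup x (inf y z)) (by simp [equations]) (a, b, c)).le
    inf_compl_le_bot := fun a =>
      (h (inf x (compl x), bot) (by simp [equations]) (a, a, a)).le
    top_le_sup_compl := fun a =>
      (h (sup x (compl x), top) (by simp [equations]) (a, a, a)).ge
    le_top := fun a => sup_eq_right.1 (h (sup x top, top) (by simp [equations]) (a, a, a))
    bot_le := fun a => sup_eq_right.1 (h (sup bot x, x) (by simp [equations]) (a, a, a)) }

end BoolTerm

/-- The instance at `(x, y, z)` of the condition that `phi e` presents a Boolean algebra. -/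
def IsBooleanAt (e : ℕ) (v : ℕ × ℕ × ℕ) : Prop :=
  (1 ∈ phi e (Nat.pair 0 v.1) ∨ 0 ∈ phi e (Nat.pair 0 v.1)) ∧
  ((∃ m, m ∈ phi e (Nat.pair 4 0) ∧ 1 ∈ phi e (Nat.pair 0 m)) ∧
    (∃ m, m ∈ phi e (Nat.pair 5 0) ∧ 1 ∈ phi e (Nat.pair 0 m))) ∧
  ((0 ∈ phi e (Nat.pair 0 v.1) ∨ 0 ∈ phi e (Nat.pair 0 v.2.1) ∨ 0 ∈ phi e (Nat.pair 0 v.2.2)) ∨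
    ((∃ m, m ∈ phi e (Nat.pair 1 (Nat.pair v.1 v.2.1)) ∧ 1 ∈ phi e (Nat.pair 0 m)) ∧
    (∃ m, m ∈ phi e (Nat.pair 2 (Nat.pair v.1 v.2.1)) ∧ 1 ∈ phi e (Nat.pair 0 m)) ∧
    (∃ m, m ∈ phi e (Nat.pair 3 v.1) ∧ 1 ∈ phi e (Nat.pair 0 m)) ∧
    ∀ s ∈ BoolTerm.equations, ∃ m, s.1.Value e v m ∧ s.2.Value e v m))

/-- The instance at `(x, y)` of the condition that `phi a` is an isomorphism between the
Boolean algebras with the indices `e` and `i`. -/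
def IsIsoAt (e i a : ℕ) (v : ℕ × ℕ) : Prop :=
  (0 ∈ phi e (Nat.pair 0 v.1) ∨ 0 ∈ phi e (Nat.pair 0 v.2) ∨
    ∃ m n, ((m ∈ phi a v.1 ∧ n ∈ phi a v.2) ∧ 1 ∈ phi i (Nat.pair 0 m) ∧ (v.1 = v.2 ∨ m ≠ n)) ∧
      ∃ k l, (k ∈ phi e (Nat.pair 1 (Nat.pair v.1 v.2)) ∧
        l ∈ phi i (Nat.pair 1 (Nat.pair m n))) ∧ l ∈ phi a k) ∧
  (0 ∈ phi i (Nat.pair 0 v.1) ∨ ∃ n, 1 ∈ phi e (Nat.pair 0 n) ∧ v.1 ∈ phi a n)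

theorem REPred.forall_mem_list {α β : Type*} [Primcodable α] {p : β → α → Prop} {l : List β}
    (h : ∀ b ∈ l, REPred (p b)) : REPred fun a => ∀ b ∈ l, p b a := by
  induction l with
  | nil => simpa using (ComputablePred.const_prop True).to_re
  | cons b l ih =>
    have := (h b (by simp)).and_comp (ih fun c hc => h c (by simp [hc]))
    exact this.of_eq fun a => by simp

theorem rePred_isBooleanAt : REPred fun x : ℕ × ℕ × ℕ × ℕ => IsBooleanAt x.1 x.2 := by
  have h : REPred fun x : ℕ × ℕ × ℕ × ℕ =>
      ∀ s ∈ BoolTerm.equations, ∃ m, s.1.Value x.1 x.2 m ∧ s.2.Value x.1 x.2 m :=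
    REPred.forall_mem_list fun s _ =>
      ((BoolTerm.rePred_value (by fun_prop) (by fun_prop) (by fun_prop) s.1).and_comp
        (BoolTerm.rePred_value (by fun_prop) (by fun_prop) (by fun_prop) s.2)).exists_comp
  unfold IsBooleanAt; fun_prop

theorem rePred_isIsoAt : REPred fun x : ℕ × ℕ × ℕ × ℕ × ℕ =>
    IsIsoAt x.1 x.2.1 x.2.2.1 x.2.2.2 := by
  unfold IsIsoAt; fun_prop

theorem CodedBA.HasIndex.not_mem_range_iff {A : CodedBA} {e : ℕ} (hA : A.HasIndex e) (n : ℕ) :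
    n ∉ Set.range A.code ↔ 0 ∈ phi e (Nat.pair 0 n) := by
  by_cases h : n ∈ Set.range A.code
  · simp [h, hA.mem_dom n h]
  · simp [h, hA.not_mem_dom n h]

theorem CodedBA.HasIndex.computes {A : CodedBA} {e : ℕ} (hA : A.HasIndex e) :
    BoolTerm.Computes A.code e where
  sup := hA.sup
  inf := hA.inf
  compl := hA.compl
  bot := hA.bot
  top := hA.top

/-- If all instances of the conditions hold, then the numbers `n` such that `phi e` accepts `n`
form a Boolean algebra with index `e`. -/
theorem mem_computableBAIndices_iff (e : ℕ) :
    e ∈ computableBAIndices ↔ ∀ v, IsBooleanAt e v := by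
  constructor
  · rintro ⟨A, hA⟩ v
    refine ⟨?_, ?_, ?_⟩
    · rw [← hA.mem_range_iff, ← hA.not_mem_range_iff]
      exact em _
    · simp [hA.bot, hA.top, ← hA.mem_range_iff]
    · simp only [← hA.not_mem_range_iff]
      by_cases h1 : v.1 ∈ Set.range A.code
      swap
      · exact Or.inl (Or.inl h1)
      by_cases h2 : v.2.1 ∈ Set.range A.code
      swap
      · exact Or.inl (Or.inr (Or.inl h2))
      by_cases h3 : v.2.2 ∈ Set.range A.code
      swap
      · exact Or.inl (Or.inr (Or.inr h3))
      obtain ⟨x, hx⟩ := h1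
      obtain ⟨y, hy⟩ := h2
      obtain ⟨z, hz⟩ := h3
      have hv : v = (A.code x, A.code y, A.code z) := by rw [hx, hy, hz]
      subst hv
      refine Or.inr ⟨?_, ?_, ?_, fun s hs => ⟨A.code (s.1.eval (x, y, z)), ?_, ?_⟩⟩
      · simp [hA.sup, ← hA.mem_range_iff]
      · simp [hA.inf, ← hA.mem_range_iff]
      · simp [hA.compl, ← hA.mem_range_iff]
      · exact (hA.computes.value_iff (x, y, z) s.1 _).2 rfl
      · rw [BoolTerm.eval_eq_of_mem_equations hs]
        exact (hA.computes.value_iff (x, y, z) s.2 _).2 rfl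
  · intro h
    let D : Type := {n // 1 ∈ phi e (Nat.pair 0 n)}
    have hdom : ∀ n, 1 ∉ phi e (Nat.pair 0 n) → 0 ∈ phi e (Nat.pair 0 n) := fun n hn =>
      (h (n, 0, 0)).1.resolve_left hn
    have hD : ∀ x : D, 0 ∉ phi e (Nat.pair 0 x.1) := fun x hx =>
      absurd (Part.mem_unique hx x.2) (by decide)
    have hops : ∀ x y z : D, _ := fun x y z => ((h (x.1, y.1, z.1)).2.2).resolve_left (by
      simp [hD])
    choose sup hsup using fun x y : D => (hops x y y).1
    choose inf hinf using fun x y : D => (hops x y y).2.1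
    choose compl hcompl using fun x : D => (hops x x x).2.2.1
    obtain ⟨⟨bot, hbot⟩, ⟨top, htop⟩⟩ := (h (0, 0, 0)).2.1
    let : Max D := ⟨fun x y => ⟨sup x y, (hsup x y).2⟩⟩
    let : Min D := ⟨fun x y => ⟨inf x y, (hinf x y).2⟩⟩
    let : Compl D := ⟨fun x => ⟨compl x, (hcompl x).2⟩⟩
    let : Bot D := ⟨⟨bot, hbot.2⟩⟩
    let : Top D := ⟨⟨top, htop.2⟩⟩
    have hcomp : BoolTerm.Computes (fun x : D => x.1) e :=
      ⟨fun x y => Part.eq_some_iff.2 (hsup x y).1, fun x y => Part.eq_some_iff.2 (hinf x y).1,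
        fun x => Part.eq_some_iff.2 (hcompl x).1, Part.eq_some_iff.2 hbot.1,
        Part.eq_some_iff.2 htop.1⟩
    let B : BooleanAlgebra D := BoolTerm.booleanAlgebra fun s hs v => by
      obtain ⟨m, h1, h2⟩ := (hops v.1 v.2.1 v.2.2).2.2.2 s hs
      exact Subtype.ext (((hcomp.value_iff v s.1 m).1 h1).symm.trans
        ((hcomp.value_iff v s.2 m).1 h2))
    exact ⟨⟨D, fun x => x.1, Subtype.val_injective⟩,
      { mem_dom := by
          rintro _ ⟨x, rfl⟩
          exact Part.eq_some_iff.2 x.2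
        not_mem_dom := fun n hn => Part.eq_some_iff.2 (hdom n fun h1 => hn ⟨⟨n, h1⟩, rfl⟩)
        sup := hcomp.sup
        inf := hcomp.inf
        compl := hcomp.compl
        bot := hcomp.bot
        top := hcomp.top }⟩

theorem CodedBA.compIso_iff {A B : CodedBA} {e i : ℕ} (hA : A.HasIndex e) (hB : B.HasIndex i) :
    A.CompIso B ↔ ∃ a, ∀ v, IsIsoAt e i a v := by
  constructor
  · rintro ⟨f, p, hp, hf⟩
    obtain ⟨a, rfl⟩ := exists_phi hp
    refine ⟨a, fun v => ⟨?_, ?_⟩⟩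
    · simp only [← hA.not_mem_range_iff]
      by_cases h1 : v.1 ∈ Set.range A.code
      swap
      · exact Or.inl h1
      by_cases h2 : v.2 ∈ Set.range A.code
      swap
      · exact Or.inr (Or.inl h2)
      obtain ⟨x, hx⟩ := h1
      obtain ⟨y, hy⟩ := h2
      have hv : v = (A.code x, A.code y) := by rw [hx, hy]
      subst hv
      refine Or.inr (Or.inr ⟨B.code (f x), B.code (f y), ⟨⟨by simp [hf], by simp [hf]⟩,
        (hB.mem_range_iff _).1 ⟨_, rfl⟩, ?_⟩, A.code (x ⊔ y), B.code (f (x ⊔ y)),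
        ⟨by simp [hA.sup], by simp [hB.sup]⟩, by simp [hf]⟩)
      by_cases hxy : x = y
      · exact Or.inl (congrArg A.code hxy)
      · exact Or.inr fun h => hxy (f.injective (B.code_injective h))
    · rw [← hB.not_mem_range_iff]
      by_cases h1 : v.1 ∈ Set.range B.code
      · obtain ⟨y, hy⟩ := h1
        exact Or.inr ⟨A.code (f.symm y), (hA.mem_range_iff _).1 ⟨_, rfl⟩, by simp [hf, hy]⟩
      · exact Or.inl h1
  · rintro ⟨a, ha⟩
    have hA0 : ∀ x, ¬ 0 ∈ phi e (Nat.pair 0 (A.code x)) := fun x => by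
      simp [← hA.not_mem_range_iff]
    have h1 := fun x y => ((ha (A.code x, A.code y)).1.resolve_left (hA0 x)).resolve_left (hA0 y)
    have hval : ∀ x, ∃ y, B.code y ∈ phi a (A.code x) := by
      intro x
      obtain ⟨m, n, ⟨⟨hm, -⟩, hdom, -⟩, -⟩ := h1 x x
      obtain ⟨y, rfl⟩ := (hB.mem_range_iff m).2 hdom
      exact ⟨y, hm⟩
    choose f hf using hval
    refine ⟨CodedBA.isoOfSup f ⟨fun x y hxy => ?_, fun y => ?_⟩ fun x y => ?_, phi a,
      partrec_phi a, fun x => Part.eq_some_iff.2 (hf x)⟩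
    · obtain ⟨m, n, ⟨⟨hm, hn⟩, -, hne⟩, -⟩ := h1 x y
      refine A.code_injective (hne.resolve_right fun h => h ?_)
      rw [Part.mem_unique hm (hf x), Part.mem_unique hn (hf y), hxy]
    · obtain ⟨n, hn, hy⟩ := (ha (B.code y, 0)).2.resolve_left (by
        simp [← hB.not_mem_range_iff])
      obtain ⟨x, rfl⟩ := (hA.mem_range_iff n).2 hn
      exact ⟨x, B.code_injective (Part.mem_unique (hf x) hy)⟩
    · obtain ⟨m, n, ⟨⟨hm, hn⟩, -, -⟩, k, l, ⟨hk, hl⟩, hkl⟩ := h1 x y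
      simp only at hm hn hk hl
      rw [Part.mem_unique hm (hf x), Part.mem_unique hn (hf y), hB.sup, Part.mem_some_iff] at hl
      rw [hA.sup, Part.mem_some_iff] at hk
      rw [hk, hl] at hkl
      exact B.code_injective (Part.mem_unique (hf _) hkl)

/-- The quantifier over all instances `b` is the only one between the number `a` of the isomorphism
and a c.e. condition. -/
theorem compIsoBA_iff_exists (e i : ℕ) : compIsoBA e i ↔
    ∃ a, ∀ b : ℕ, (IsBooleanAt e (b.unpair.1, b.unpair.2.unpair.1, b.unpair.2.unpair.2) ∧
      IsBooleanAt i (b.unpair.1, b.unpair.2.unpair.1, b.unpair.2.unpair.2)) ∧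
      IsIsoAt e i a b.unpair := by
  constructor
  · rintro ⟨A, B, hA, hB, h⟩
    obtain ⟨a, ha⟩ := (CodedBA.compIso_iff hA hB).1 h
    exact ⟨a, fun b => ⟨⟨(mem_computableBAIndices_iff e).1 ⟨A, hA⟩ _,
      (mem_computableBAIndices_iff i).1 ⟨B, hB⟩ _⟩, ha _⟩⟩
  · rintro ⟨a, ha⟩
    obtain ⟨A, hA⟩ := (mem_computableBAIndices_iff e).2 fun v => by
      simpa using (ha (Nat.pair v.1 (Nat.pair v.2.1 v.2.2))).1.1
    obtain ⟨B, hB⟩ := (mem_computableBAIndices_iff i).2 fun v => by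
      simpa using (ha (Nat.pair v.1 (Nat.pair v.2.1 v.2.2))).1.2
    refine ⟨A, B, hA, hB, (CodedBA.compIso_iff hA hB).2 ⟨a, fun v => ?_⟩⟩
    simpa using (ha (Nat.pair v.1 v.2)).2

theorem isSigmaThree_compIsoBA : IsSigmaThree compIsoBA := by
  have h1 := rePred_isBooleanAt
  have h2 := rePred_isIsoAt
  have h : REPred fun x : ℕ × ℕ × ℕ × ℕ => (IsBooleanAt x.1
        (x.2.2.2.unpair.1, x.2.2.2.unpair.2.unpair.1, x.2.2.2.unpair.2.unpair.2) ∧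
      IsBooleanAt x.2.1
        (x.2.2.2.unpair.1, x.2.2.2.unpair.2.unpair.1, x.2.2.2.unpair.2.unpair.2)) ∧
      IsIsoAt x.1 x.2.1 x.2.2.1 x.2.2.2.unpair :=
    ((h1.comp_computable (f := fun x : ℕ × ℕ × ℕ × ℕ => (x.1,
        x.2.2.2.unpair.1, x.2.2.2.unpair.2.unpair.1, x.2.2.2.unpair.2.unpair.2))
        (by fun_prop)).and_comp
      (h1.comp_computable (f := fun x : ℕ × ℕ × ℕ × ℕ => (x.2.1,
        x.2.2.2.unpair.1, x.2.2.2.unpair.2.unpair.1, x.2.2.2.unpair.2.unpair.2))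
        (by fun_prop))).and_comp
      (h2.comp_computable (f := fun x : ℕ × ℕ × ℕ × ℕ => (x.1, x.2.1, x.2.2.1, x.2.2.2.unpair))
        (by fun_prop))
  obtain ⟨R, hR, hR'⟩ := REPred.iff_exists_computablePred.1 h
  refine ⟨fun x => R ((x.1, x.2.1, x.2.2.1, x.2.2.2.1), x.2.2.2.2), by fun_prop, fun e i => ?_⟩
  rw [compIsoBA_iff_exists]
  exact exists_congr fun a => forall_congr' fun b => hR' (e, i, a, b)

/-! ### Finite lists of endpoints -/

section Toggle

variable {α β : Type*} {lt : α → α → Bool} {lt' : β → β → Bool} {c : α → β}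

/-- The list of the larger ones of `a` and `b`, where `a` and `b` run through two lists. -/
def meetList (lt : α → α → Bool) (g h : List α) : List α :=
  g.flatMap fun a => h.map fun b => if lt a b then b else a

theorem map_meetList (h : ∀ a b, lt' (c a) (c b) = lt a b) (g k : List α) :
    (meetList lt g k).map c = meetList lt' (g.map c) (k.map c) := by
  simp only [meetList, List.map_flatMap, List.flatMap_map, List.map_map]
  congr! 3 with a
  funext b
  simp only [Function.comp_apply, h]
  split_ifs <;> rfl

variable [DecidableEq α] [DecidableEq β]

/-- Insertion of `a` at its place in an increasing list, or removal of `a` if it is there. -/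
def toggle (lt : α → α → Bool) (a : α) (l : List α) : List α :=
  l.filter (fun b => lt b a) ++ ((if ∃ b ∈ l, b = a then [] else [a]) ++ l.filter (lt a))

/-- The increasing list of the elements that occur in `g` an odd number of times. -/
def oddSort (lt : α → α → Bool) (g : List α) : List α := g.foldr (toggle lt) []

theorem map_toggle (hc : Function.Injective c) (h : ∀ a b, lt' (c a) (c b) = lt a b) (a : α)
    (l : List α) : (toggle lt a l).map c = toggle lt' (c a) (l.map c) := by
  have h1 : (∃ b ∈ l.map c, b = c a) ↔ ∃ b ∈ l, b = a := by simp [hc.eq_iff]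
  simp only [toggle, List.map_append, List.filter_map, h1]
  congr 1
  · simp [Function.comp_def, h]
  · congr 1
    · split_ifs <;> simp
    · simp [Function.comp_def, h]

theorem map_oddSort (hc : Function.Injective c) (h : ∀ a b, lt' (c a) (c b) = lt a b)
    (g : List α) : (oddSort lt g).map c = oddSort lt' (g.map c) := by
  induction g with
  | nil => rfl
  | cons a g ih =>
    simp only [oddSort, List.foldr_cons, List.map_cons] at ih ⊢
    rw [map_toggle hc h, ih]

end Toggle

section OddSet

variable {L : Type} [LinearOrder L]

/-- The set of points with an odd number of entries of the list `g` below or equal to them. -/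
def oddSet (g : List L) : Set L := {x | Odd (g.countP fun a => decide (a ≤ x))}

@[simp]
theorem mem_oddSet_nil {x : L} : ¬ x ∈ oddSet ([] : List L) := by simp [oddSet]

theorem mem_oddSet_append {g h : List L} {x : L} :
    x ∈ oddSet (g ++ h) ↔ ¬ (x ∈ oddSet g ↔ x ∈ oddSet h) := by
  simp only [oddSet, Set.mem_ofPred_eq, List.countP_append, Nat.odd_add, ← Nat.not_odd_iff_even]
  tauto

@[simp]
theorem mem_oddSet_cons {a : L} {g : List L} {x : L} :
    x ∈ oddSet (a :: g) ↔ ¬ (a ≤ x ↔ x ∈ oddSet g) := by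
  by_cases h : a ≤ x <;> simp [oddSet, h, Nat.odd_add_one]

theorem oddSet_eq_of_perm {g h : List L} (hgh : g.Perm h) : oddSet g = oddSet h := by
  ext x
  simp only [oddSet, Set.mem_ofPred_eq, hgh.countP_eq]

theorem unionIco_eq_oddSet {l : List L} (h : l.Pairwise (· < ·)) : unionIco l = oddSet l :=
  Set.ext fun x => mem_unionIco_iff x l h

theorem pairwise_toggle (a : L) {l : List L} (h : l.Pairwise (· < ·)) :
    (toggle (fun a b => decide (a < b)) a l).Pairwise (· < ·) := by
  unfold toggle
  rw [List.pairwise_append, List.pairwise_append]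
  refine ⟨h.filter _, ⟨by split_ifs <;> simp, h.filter _, ?_⟩, ?_⟩
  · intro x hx y hy
    have : x = a := by split_ifs at hx <;> simp_all
    simp_all
  · intro x hx y hy
    have h1 : x < a := by simp_all
    rcases List.mem_append.1 hy with hy | hy
    · have : y = a := by split_ifs at hy <;> simp_all
      simp_all
    · have h2 : a < y := by simp_all
      exact h1.trans h2

theorem mem_toggle {a : L} {l : List L} {x : L} :
    x ∈ toggle (fun a b => decide (a < b)) a l ↔ x ≠ a ∧ x ∈ l ∨ x = a ∧ a ∉ l := by
  unfold toggle
  rcases lt_trichotomy x a with h | h | h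
  · simp [h.not_gt, h.ne, h]
  · subst h
    simp
  · simp [h.not_gt, h.ne', h]

theorem mem_oddSet_toggle {a : L} {l : List L} (h : l.Pairwise (· < ·)) {x : L} :
    x ∈ oddSet (toggle (fun a b => decide (a < b)) a l) ↔ ¬ (a ≤ x ↔ x ∈ oddSet l) := by
  have hn := (pairwise_toggle a h).imp ne_of_lt
  have hl := h.imp ne_of_lt
  by_cases ha : a ∈ l
  · have hp : (a :: toggle (fun a b => decide (a < b)) a l).Perm l := by
      rw [List.perm_ext_iff_of_nodup (List.nodup_cons.2 ⟨by simp [mem_toggle, ha], hn⟩) hl]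
      intro y
      by_cases hy : y = a <;> simp [mem_toggle, hy, ha]
    rw [← oddSet_eq_of_perm hp, mem_oddSet_cons]
    tauto
  · have hp : (toggle (fun a b => decide (a < b)) a l).Perm (a :: l) := by
      rw [List.perm_ext_iff_of_nodup hn (List.nodup_cons.2 ⟨ha, hl⟩)]
      intro y
      by_cases hy : y = a <;> simp [mem_toggle, hy, ha]
    rw [oddSet_eq_of_perm hp, mem_oddSet_cons]

theorem pairwise_oddSort (g : List L) :
    (oddSort (fun a b => decide (a < b)) g).Pairwise (· < ·) := by
  induction g with
  | nil => exact List.Pairwise.nil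
  | cons a g ih => exact pairwise_toggle a ih

theorem oddSet_oddSort (g : List L) :
    oddSet (oddSort (fun a b => decide (a < b)) g) = oddSet g := by
  induction g with
  | nil => rfl
  | cons a g ih =>
    ext x
    rw [mem_oddSet_cons, ← ih]
    exact mem_oddSet_toggle (pairwise_oddSort g)

/-- The number of entries of `meetList g h` that are at most `x` is the product of the numbers for
`g` and `h`, and a product is odd if and only if both factors are. -/
theorem mem_oddSet_meetList {g h : List L} {x : L} :
    x ∈ oddSet (meetList (fun a b => decide (a < b)) g h) ↔ x ∈ oddSet g ∧ x ∈ oddSet h := by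
  have key : ∀ a, x ∈ oddSet (h.map fun b => if decide (a < b) then b else a) ↔
      a ≤ x ∧ x ∈ oddSet h := by
    intro a
    induction h with
    | nil => simp
    | cons b h ih =>
      rw [List.map_cons, mem_oddSet_cons, ih, mem_oddSet_cons]
      have : (if decide (a < b) then b else a) ≤ x ↔ a ≤ x ∧ b ≤ x := by
        rw [← max_le_iff, max_def_lt]
        simp
      tauto
  induction g with
  | nil => simp [meetList]
  | cons a g ih =>
    have h1 : meetList (fun a b => decide (a < b)) (a :: g) h =
        (h.map fun b => if decide (a < b) then b else a) ++
          meetList (fun a b => decide (a < b)) g h := List.flatMap_cons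
    have ih' : x ∈ oddSet (meetList (fun a b => decide (a < b)) g h) ↔
      x ∈ oddSet g ∧ x ∈ oddSet h := ih
    rw [h1, mem_oddSet_append, ih', key, mem_oddSet_cons]
    tauto

theorem oddSet_mem_intalg [OrderBot L] (g : List L) : oddSet g ∈ intalg L := by
  induction g with
  | nil =>
    have : oddSet ([] : List L) = ⊥ := Set.eq_empty_of_forall_notMem fun x => mem_oddSet_nil
    rw [this]
    exact BooleanSubalgebra.bot_mem
  | cons a g ih =>
    have h1 : Set.Ici a ∈ intalg L := BooleanSubalgebra.subset_closure (Or.inr ⟨a, rfl⟩)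
    have : oddSet (a :: g) = (Set.Ici a ⊓ (oddSet g)ᶜ) ⊔ (oddSet g ⊓ (Set.Ici a)ᶜ) := by
      ext x
      simp only [mem_oddSet_cons, Set.sup_eq_union, Set.inf_eq_inter, Set.mem_union,
        Set.mem_inter_iff, Set.mem_compl_iff, Set.mem_Ici]
      tauto
    rw [this]
    exact (intalg L).sup_mem ((intalg L).inf_mem h1 ((intalg L).compl_mem ih))
      ((intalg L).inf_mem ih ((intalg L).compl_mem h1))

/-- The order of the elements of `L`, carried over to their names. -/
def nameLT (c : L ≃ ℕ) (m n : ℕ) : Bool := decide (c.symm m < c.symm n)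

theorem nameLT_name (c : L ≃ ℕ) (a b : L) : nameLT c (c a) (c b) = decide (a < b) := by
  simp [nameLT]

variable [OrderBot L]

/-- The element of the interval algebra that is given by an arbitrary list of endpoints. -/
def toIntalg (g : List L) : intalg L := ⟨oddSet g, oddSet_mem_intalg g⟩

theorem toIntalg_eq_iff {g : List L} {S : intalg L} :
    toIntalg g = S ↔ ∀ x, x ∈ oddSet g ↔ x ∈ S.1 := by
  rw [Subtype.ext_iff, Set.ext_iff]
  rfl

theorem oddSet_endpoints (S : intalg L) : oddSet (endpoints S) = S.1 := by
  rw [← unionIco_eq_oddSet (endpoints_pairwise S), unionIco_endpoints]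

theorem toIntalg_endpoints (S : intalg L) : toIntalg (endpoints S) = S :=
  Subtype.ext (oddSet_endpoints S)

theorem endpoints_toIntalg (g : List L) :
    endpoints (toIntalg g) = oddSort (fun a b => decide (a < b)) g := by
  refine unionIco_inj _ _ (endpoints_pairwise _) (pairwise_oddSort g) ?_
  rw [unionIco_endpoints, unionIco_eq_oddSet (pairwise_oddSort g), oddSet_oddSort]
  rfl

theorem endpoints_toIntalg_of_pairwise {g : List L} (hg : g.Pairwise (· < ·)) :
    endpoints (toIntalg g) = g := by
  refine unionIco_inj _ _ (endpoints_pairwise _) hg ?_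
  rw [unionIco_endpoints, unionIco_eq_oddSet hg]
  rfl

theorem toIntalg_sup (g h : List L) : toIntalg g ⊔ toIntalg h =
    toIntalg (g ++ h ++ meetList (fun a b => decide (a < b)) g h) := by
  refine (toIntalg_eq_iff.2 fun x => ?_).symm
  have : x ∈ (toIntalg g ⊔ toIntalg h).1 ↔ x ∈ oddSet g ∨ x ∈ oddSet h := Iff.rfl
  rw [this, mem_oddSet_append, mem_oddSet_append, mem_oddSet_meetList]
  tauto

theorem toIntalg_inf (g h : List L) : toIntalg g ⊓ toIntalg h =
    toIntalg (meetList (fun a b => decide (a < b)) g h) := by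
  refine (toIntalg_eq_iff.2 fun x => ?_).symm
  exact mem_oddSet_meetList

theorem toIntalg_compl (g : List L) : (toIntalg g)ᶜ = toIntalg (⊥ :: g) := by
  refine (toIntalg_eq_iff.2 fun x => ?_).symm
  have : x ∈ ((toIntalg g)ᶜ).1 ↔ ¬ x ∈ oddSet g := Iff.rfl
  rw [this, mem_oddSet_cons]
  simp

theorem toIntalg_nil : toIntalg ([] : List L) = ⊥ :=
  toIntalg_eq_iff.2 fun _ => iff_of_false mem_oddSet_nil id

theorem toIntalg_bot : toIntalg [(⊥ : L)] = ⊤ :=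
  toIntalg_eq_iff.2 fun _ => iff_of_true (by simp) trivial

theorem map_endpoints_toIntalg (c : L ≃ ℕ) (g : List L) :
    (endpoints (toIntalg g)).map c = oddSort (nameLT c) (g.map c) := by
  rw [endpoints_toIntalg, map_oddSort c.injective (nameLT_name c)]

theorem map_endpoints_sup (c : L ≃ ℕ) (S T : intalg L) : (endpoints (S ⊔ T)).map c =
    oddSort (nameLT c) ((endpoints S).map c ++ (endpoints T).map c ++
      meetList (nameLT c) ((endpoints S).map c) ((endpoints T).map c)) := by
  conv_lhs => rw [← toIntalg_endpoints S, ← toIntalg_endpoints T, toIntalg_sup]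
  rw [map_endpoints_toIntalg, List.map_append, List.map_append, map_meetList (nameLT_name c)]

theorem map_endpoints_inf (c : L ≃ ℕ) (S T : intalg L) : (endpoints (S ⊓ T)).map c =
    oddSort (nameLT c)
      (meetList (nameLT c) ((endpoints S).map c) ((endpoints T).map c)) := by
  conv_lhs => rw [← toIntalg_endpoints S, ← toIntalg_endpoints T, toIntalg_inf]
  rw [map_endpoints_toIntalg, map_meetList (nameLT_name c)]

theorem map_endpoints_compl (c : L ≃ ℕ) (S : intalg L) : (endpoints Sᶜ).map c =
    oddSort (nameLT c) (c ⊥ :: (endpoints S).map c) := by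
  conv_lhs => rw [← toIntalg_endpoints S, toIntalg_compl]
  rw [map_endpoints_toIntalg, List.map_cons]

theorem map_endpoints_bot (c : L ≃ ℕ) : (endpoints (⊥ : intalg L)).map c =
    oddSort (nameLT c) [] := by
  rw [← toIntalg_nil, map_endpoints_toIntalg, List.map_nil]

theorem map_endpoints_top (c : L ≃ ℕ) : (endpoints (⊤ : intalg L)).map c =
    oddSort (nameLT c) [c ⊥] := by
  rw [← toIntalg_bot, map_endpoints_toIntalg, List.map_cons, List.map_nil]

/-- The domain of the canonical presentation consists of the codes of increasing lists. -/
theorem mem_range_code_iff (c : L ≃ ℕ) (l : List ℕ) :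
    Encodable.encode l ∈ Set.range (intalgBA L c.toEmbedding).code ↔
      oddSort (nameLT c) l = l := by
  constructor
  · rintro ⟨S, hS⟩
    obtain ⟨g, rfl⟩ : ∃ g, toIntalg g = S := ⟨_, toIntalg_endpoints S⟩
    have h1 : (endpoints (toIntalg g)).map c = l := Encodable.encode_injective hS
    have h2 := map_endpoints_toIntalg c (endpoints (toIntalg g))
    rw [toIntalg_endpoints, h1] at h2
    exact h2.symm
  · intro h
    refine ⟨toIntalg (l.map c.symm), congrArg Encodable.encode (?_ : _ = l)⟩
    refine (map_endpoints_toIntalg c _).trans ?_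
    rw [List.map_map]
    simp [h]

end OddSet

/-! ### Indices of the interval algebras -/

namespace Presentation

variable {V : ℕ → Set ℕ} (A : Presentation V)

/-- The canonical presentation of the interval algebra of the `e`-th order. -/
noncomputable abbrev algebra (e : ℕ) : CodedBA :=
  intalgBA (Expansion (V e)) (A.name e).toEmbedding

theorem computable_nameLT {α : Type*} [Primcodable α] {e m n : α → ℕ} (he : Computable e)
    (hm : Computable m) (hn : Computable n) :
    Computable fun a => nameLT (A.name (e a)) (m a) (n a) := by
  have h : ComputablePred fun a =>
      ¬ (A.name (e a)).symm (n a) ≤ (A.name (e a)).symm (m a) :=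
    (A.computablePred_le.comp_computable (he.pair (hn.pair hm))).not
  refine h.decide.of_eq fun a => ?_
  simp [nameLT]

theorem computable_oddSort {α : Type*} [Primcodable α] {e : α → ℕ} {l : α → List ℕ}
    (he : Computable e) (hl : Computable l) :
    Computable fun a => oddSort (nameLT (A.name (e a))) (l a) := by
  have h1 : Computable fun x : (α × ℕ × List ℕ) × ℕ => nameLT (A.name (e x.1.1)) x.2 x.1.2.1 :=
    A.computable_nameLT (by fun_prop) (by fun_prop) (by fun_prop)
  have h2 : Computable fun x : (α × ℕ × List ℕ) × ℕ => nameLT (A.name (e x.1.1)) x.1.2.1 x.2 :=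
    A.computable_nameLT (by fun_prop) (by fun_prop) (by fun_prop)
  have h3 : Computable fun x : α × ℕ × List ℕ =>
      toggle (nameLT (A.name (e x.1))) x.2.1 x.2.2 := by
    unfold toggle; fun_prop
  exact Computable.foldr_comp hl (Computable.const []) h3

theorem computable_meetList {α : Type*} [Primcodable α] {e : α → ℕ} {l m : α → List ℕ}
    (he : Computable e) (hl : Computable l) (hm : Computable m) :
    Computable fun a => meetList (nameLT (A.name (e a))) (l a) (m a) := by
  have h1 : Computable fun x : (α × ℕ) × ℕ => nameLT (A.name (e x.1.1)) x.1.2 x.2 :=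
    A.computable_nameLT (by fun_prop) (by fun_prop) (by fun_prop)
  unfold meetList; fun_prop

/-- The function number `k` in the definition of an index of a Boolean algebra, for the `e`-th
interval algebra: membership in the domain, join, meet, complement, bottom and top. A join is the
symmetric difference of its terms and their meet. -/
noncomputable def operation (e k n : ℕ) : ℕ :=
  if k = 0 then
    if oddSort (nameLT (A.name e)) (Denumerable.ofNat (List ℕ) n) = Denumerable.ofNat (List ℕ) n
      then 1 else 0
  else Encodable.encode (oddSort (nameLT (A.name e))
    (if k = 1 then
      Denumerable.ofNat (List ℕ) n.unpair.1 ++ Denumerable.ofNat (List ℕ) n.unpair.2 ++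
        meetList (nameLT (A.name e)) (Denumerable.ofNat (List ℕ) n.unpair.1)
          (Denumerable.ofNat (List ℕ) n.unpair.2)
    else if k = 2 then
      meetList (nameLT (A.name e)) (Denumerable.ofNat (List ℕ) n.unpair.1)
        (Denumerable.ofNat (List ℕ) n.unpair.2)
    else if k = 3 then 0 :: Denumerable.ofNat (List ℕ) n
    else if k = 4 then [] else [0]))

theorem computable_operation :
    Computable fun x : ℕ => A.operation x.unpair.1 x.unpair.2.unpair.1 x.unpair.2.unpair.2 := by
  have h1 : Computable fun x : ℕ => meetList (nameLT (A.name x.unpair.1))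
      (Denumerable.ofNat (List ℕ) x.unpair.2.unpair.2.unpair.1)
      (Denumerable.ofNat (List ℕ) x.unpair.2.unpair.2.unpair.2) :=
    A.computable_meetList (by fun_prop) (by fun_prop) (by fun_prop)
  have h2 : Computable fun x : ℕ => oddSort (nameLT (A.name x.unpair.1))
      (Denumerable.ofNat (List ℕ) x.unpair.2.unpair.2) :=
    A.computable_oddSort (by fun_prop) (by fun_prop)
  unfold operation
  refine Computable.ite_comp (by fun_prop) (by fun_prop) (Computable.encode_comp ?_)
  exact A.computable_oddSort (by fun_prop) (by fun_prop)

theorem name_bot (e : ℕ) : A.name e ⊥ = 0 := by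
  rw [Expansion.bot_eq_min, A.name_min]

theorem ofNat_code (e : ℕ) (S : (A.algebra e).Carrier) :
    Denumerable.ofNat (List ℕ) ((A.algebra e).code S) = (endpoints S).map (A.name e) :=
  Denumerable.ofNat_encode _

theorem hasIndex_of_phi_eq {e i : ℕ}
    (h : ∀ k n, phi i (Nat.pair k n) = Part.some (A.operation e k n)) :
    (A.algebra e).HasIndex i where
  mem_dom n hn := by
    rw [← Denumerable.encode_ofNat (α := List ℕ) n] at hn
    rw [h, operation, if_pos rfl, if_pos ((mem_range_code_iff _ _).1 hn)]
  not_mem_dom n hn := by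
    rw [← Denumerable.encode_ofNat (α := List ℕ) n] at hn
    rw [h, operation, if_pos rfl, if_neg fun h => hn ((mem_range_code_iff _ _).2 h)]
  sup S T := by
    refine (h _ _).trans (congrArg Part.some ?_)
    refine Eq.trans ?_ (congrArg Encodable.encode (map_endpoints_sup (A.name e) S T).symm)
    simp [operation, A.ofNat_code]
  inf S T := by
    refine (h _ _).trans (congrArg Part.some ?_)
    refine Eq.trans ?_ (congrArg Encodable.encode (map_endpoints_inf (A.name e) S T).symm)
    simp [operation, A.ofNat_code]
  compl S := by
    refine (h _ _).trans (congrArg Part.some ?_)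
    refine Eq.trans ?_ (congrArg Encodable.encode (map_endpoints_compl (A.name e) S).symm)
    simp [operation, A.ofNat_code, A.name_bot]
  bot := by
    refine (h _ _).trans (congrArg Part.some ?_)
    refine Eq.trans ?_ (congrArg Encodable.encode (map_endpoints_bot (A.name e)).symm)
    simp [operation]
  top := by
    refine (h _ _).trans (congrArg Part.some ?_)
    refine Eq.trans ?_ (congrArg Encodable.encode (map_endpoints_top (A.name e)).symm)
    simp [operation, A.name_bot]

/-- By the `s-m-n` theorem, the interval algebras have indices that depend computably on `e`. -/
theorem exists_index : ∃ g : ℕ → ℕ, Computable g ∧ Function.Injective g ∧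
    ∀ e, (A.algebra e).HasIndex (g e) := by
  obtain ⟨c, hc⟩ := Code.exists_code.1 (Partrec.nat_iff.1 A.computable_operation.partrec)
  refine ⟨fun e => Encodable.encode (Code.curry c e), ?_, fun e i h => ?_, fun e => ?_⟩
  · exact Computable.encode.comp
      (Code.primrec₂_curry.to_comp.comp (Computable.const c) Computable.id)
  · exact (Code.curry_inj (Encodable.encode_injective h)).2
  · refine A.hasIndex_of_phi_eq fun k n => ?_
    simp [phi, Code.eval_curry, hc]

end Presentation

/-! ### From one-one equivalences to isomorphisms -/

namespace Expansion

variable {V U : Set ℕ}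

/-- The map between orders that moves each block `x` onto the block `p x`. -/
def transport (p : ℕ ≃ ℕ) (h : ∀ x, x ∈ V ↔ p x ∈ U) : Expansion V ≃ Expansion U where
  toFun z := mk (p z.block) z.pos (by simpa [← h] using z.pos_spec)
  invFun w := mk (p.symm w.block) w.pos (by simpa [h] using w.pos_spec)
  left_inv z := Expansion.ext (by simp) (by simp)
  right_inv w := Expansion.ext (by simp) (by simp)

@[simp]
theorem block_transport (p : ℕ ≃ ℕ) (h : ∀ x, x ∈ V ↔ p x ∈ U) (z : Expansion V) :
    (transport p h z).block = p z.block := rfl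

@[simp]
theorem pos_transport (p : ℕ ≃ ℕ) (h : ∀ x, x ∈ V ↔ p x ∈ U) (z : Expansion V) :
    (transport p h z).pos = z.pos := rfl

@[simp]
theorem block_transport_symm (p : ℕ ≃ ℕ) (h : ∀ x, x ∈ V ↔ p x ∈ U) (w : Expansion U) :
    ((transport p h).symm w).block = p.symm w.block := rfl

@[simp]
theorem pos_transport_symm (p : ℕ ≃ ℕ) (h : ∀ x, x ∈ V ↔ p x ∈ U) (w : Expansion U) :
    ((transport p h).symm w).pos = w.pos := rfl

theorem min_le_iff {x : ℕ} {z : Expansion V} : Expansion.min V x ≤ z ↔ x ≤ z.block := by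
  rw [le_iff, block_min, pos_min]
  simp only [z.pos_spec.1, and_true]
  exact le_iff_lt_or_eq.symm

/-- Endpoints of the image of `[z, ∞)` under `transport p h`. The blocks in the complement of
`[z, ∞)`, of which there are finitely many, are mapped to blocks, and the part of the block of `z`
below `z` is mapped to the corresponding part of a block. -/
def imageIci (p : ℕ ≃ ℕ) (h : ∀ x, x ∈ V ↔ p x ∈ U) (z : Expansion V) : List (Expansion U) :=
  Expansion.min U 0 :: ((List.range z.block).flatMap
      (fun y => [Expansion.min U (p y), Expansion.min U (p y + 1)]) ++
    [Expansion.min U (p z.block), transport p h z])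

theorem mem_oddSet_imageIci (p : ℕ ≃ ℕ) (h : ∀ x, x ∈ V ↔ p x ∈ U) (z : Expansion V)
    (w : Expansion U) : w ∈ oddSet (imageIci p h z) ↔ z ≤ (transport p h).symm w := by
  have key : ∀ n, w ∈ oddSet ((List.range n).flatMap
      fun y => [Expansion.min U (p y), Expansion.min U (p y + 1)]) ↔ p.symm w.block < n := by
    intro n
    induction n with
    | zero => simp
    | succ n ih =>
      rw [List.range_succ, List.flatMap_append, mem_oddSet_append, ih]
      have h1 : p.symm w.block = n ↔ w.block = p n := p.symm_apply_eq
      simp only [List.flatMap_cons, List.flatMap_nil, List.append_nil, mem_oddSet_cons,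
        mem_oddSet_nil, min_le_iff]
      rcases lt_trichotomy w.block (p n) with h2 | h2 | h2
      · have := h1.not.2 h2.ne
        simp [h2.not_ge, show ¬ p n + 1 ≤ w.block by omega]
        omega
      · have := h1.2 h2
        simp [h2, show ¬ p n + 1 ≤ p n by omega]
      · have := h1.not.2 h2.ne'
        simp [h2.le, show p n + 1 ≤ w.block by omega]
        omega
  unfold imageIci
  rw [mem_oddSet_cons, mem_oddSet_append, key]
  simp only [mem_oddSet_cons, mem_oddSet_nil, min_le_iff]
  rw [le_iff, le_iff]
  simp only [block_transport, pos_transport, block_transport_symm, pos_transport_symm]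
  have h1 : p.symm w.block = z.block ↔ w.block = p z.block := p.symm_apply_eq
  rcases lt_trichotomy w.block (p z.block) with h2 | h2 | h2
  · have := h1.not.2 h2.ne
    simp [h2.not_ge, h2.not_gt, h2.ne', Ne.symm this]
    omega
  · have := h1.2 h2
    simp [h2]
  · have := h1.not.2 h2.ne'
    simp [h2.le, h2, Ne.symm this]
    omega

theorem mem_oddSet_flatMap_imageIci (p : ℕ ≃ ℕ) (h : ∀ x, x ∈ V ↔ p x ∈ U)
    (g : List (Expansion V)) (w : Expansion U) :
    w ∈ oddSet (g.flatMap (imageIci p h)) ↔ (transport p h).symm w ∈ oddSet g := by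
  induction g with
  | nil => simp
  | cons a g ih =>
    rw [List.flatMap_cons, mem_oddSet_append, mem_oddSet_imageIci, ih, mem_oddSet_cons]

/-- The isomorphism of interval algebras that is induced by `transport p h`. -/
noncomputable def intalgIso (p : ℕ ≃ ℕ) (h : ∀ x, x ∈ V ↔ p x ∈ U) :
    intalg (Expansion V) ≃o intalg (Expansion U) :=
  CodedBA.isoOfSup (fun S => toIntalg ((endpoints S).flatMap (imageIci p h)))
    (by
      constructor
      · intro S T hST
        refine Subtype.ext (Set.ext fun z => ?_)
        have := Set.ext_iff.1 (congrArg Subtype.val hST) (transport p h z)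
        simpa [toIntalg, mem_oddSet_flatMap_imageIci, oddSet_endpoints] using this
      · intro T
        have h' : ∀ x, x ∈ U ↔ p.symm x ∈ V := fun x => by rw [h, p.apply_symm_apply]
        refine ⟨toIntalg ((endpoints T).flatMap (imageIci p.symm h')), ?_⟩
        refine toIntalg_eq_iff.2 fun w => ?_
        rw [mem_oddSet_flatMap_imageIci, oddSet_endpoints, ← oddSet_endpoints T]
        exact mem_oddSet_flatMap_imageIci p.symm h' _ _ |>.trans (by
          rw [show (transport p.symm h').symm ((transport p h).symm w) = w from
            Expansion.ext (by simp [transport]) (by simp [transport])]))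
    (fun S T => by
      refine toIntalg_eq_iff.2 fun w => ?_
      have h1 : ∀ A B : intalg (Expansion U), w ∈ (A ⊔ B).1 ↔ w ∈ A.1 ∨ w ∈ B.1 :=
        fun _ _ => Iff.rfl
      rw [h1]
      simp only [toIntalg, mem_oddSet_flatMap_imageIci, oddSet_endpoints]
      rfl)

end Expansion

namespace Presentation

variable {V : ℕ → Set ℕ} (A : Presentation V)

open Expansion in
/-- One-one equivalent sets have computably isomorphic interval algebras. -/
theorem compIso_of_oneOneEquiv {e i : ℕ}
    (hVU : OneOneEquiv (fun x => x ∈ V e) (fun x => x ∈ V i)) :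
    (A.algebra e).CompIso (A.algebra i) := by
  obtain ⟨p, hp, h⟩ := hVU.exists_equiv
  have hb := A.computable_block
  have hn := A.computable_num
  have hd := A.computable_den
  -- `ψ`, `gen` and `q` are `transport`, `imageIci` and `intalgIso` on the level of names
  let ψ : ℕ → ℕ := fun n => A.name i (transport p h ((A.name e).symm n))
  have hψ : Computable ψ := by
    refine Computable.of_graph ?_
    have : ComputablePred fun x : ℕ × ℕ => A.block (i, x.2) = p (A.block (e, x.1)) ∧
        A.num (i, x.2) * A.den (e, x.1) = A.num (e, x.1) * A.den (i, x.2) := by fun_prop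
    refine this.of_eq fun x => ?_
    rw [← A.pos_eq_iff, ← A.block_name, ← A.block_name]
    have h1 : ψ x.1 = x.2 ↔ (A.name i).symm x.2 = transport p h ((A.name e).symm x.1) := by
      rw [Equiv.symm_apply_eq]
      exact eq_comm
    rw [h1]
    constructor
    · rintro ⟨h2, h3⟩
      exact Expansion.ext h2 h3
    · intro h2
      rw [h2]
      exact ⟨rfl, rfl⟩
  let gen : ℕ → List ℕ := fun n => 0 :: ((List.range (A.block (e, n))).flatMap
    (fun y => [2 * p y, 2 * (p y + 1)]) ++ [2 * p (A.block (e, n)), ψ n])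
  have hgen : Computable gen := by fun_prop
  have hmap : ∀ g : List (Expansion (V e)), (g.flatMap (imageIci p h)).map (A.name i) =
      (g.map (A.name e)).flatMap gen := by
    intro g
    rw [List.map_flatMap, List.flatMap_map]
    congr 1
    funext z
    have hz : A.block (e, A.name e z) = z.block := by
      rw [← A.block_name, Equiv.symm_apply_apply]
    simp [imageIci, gen, ψ, hz, A.name_min, List.map_flatMap]
  let q : ℕ → ℕ := fun n => Encodable.encode (oddSort (nameLT (A.name i))
    ((Denumerable.ofNat (List ℕ) n).flatMap gen))
  have hq : Computable q := by
    have := A.computable_oddSort (e := fun _ : ℕ => i)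
      (l := fun n => (Denumerable.ofNat (List ℕ) n).flatMap gen) (by fun_prop) (by fun_prop)
    fun_prop
  refine ⟨intalgIso p h, q, Partrec.nat_iff.1 hq.partrec, fun S => ?_⟩
  refine congrArg Part.some (?_ : q _ = Encodable.encode _)
  have h1 := map_endpoints_toIntalg (A.name i) ((endpoints S).flatMap (imageIci p h))
  rw [hmap] at h1
  refine Eq.trans ?_ (congrArg Encodable.encode h1.symm)
  simp only [q, A.ofNat_code]

end Presentation

/-! ### From isomorphisms to one-one equivalences -/

namespace Expansion

variable {V : Set ℕ}

/-- The block of `x`, as an element of the interval algebra. -/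
noncomputable def blockSet (V : Set ℕ) (x : ℕ) : intalg (Expansion V) :=
  toIntalg [Expansion.min V x, Expansion.min V (x + 1)]

theorem mem_blockSet {x : ℕ} {z : Expansion V} : z ∈ (blockSet V x).1 ↔ z.block = x := by
  show z ∈ oddSet _ ↔ _
  simp only [mem_oddSet_cons, mem_oddSet_nil, min_le_iff]
  by_cases h : x ≤ z.block
  · simp [h]
    omega
  · simp [h]
    omega

theorem blockSet_injective : Function.Injective (blockSet V) := fun x y h => by
  have : Expansion.min V x ∈ (blockSet V y).1 := h ▸ mem_blockSet.2 rfl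
  exact mem_blockSet.1 this

/-- Points of a block `[0,1)_ℚ` have no immediate successor. -/
theorem exists_between {a b : Expansion V} (ha : a.block ∈ V) (h : a < b) :
    ∃ c, a < c ∧ c < b := by
  obtain ⟨h0, h1, -⟩ := a.pos_spec
  rcases lt_iff.1 h with hb | ⟨hb, hpos⟩
  · exact ⟨mk a.block ((a.pos + 1) / 2) ⟨by linarith, by linarith, Or.inr ha⟩,
      lt_iff.2 (Or.inr ⟨rfl, by simp only [pos_mk]; linarith⟩), lt_iff.2 (Or.inl hb)⟩
  · have h2 := b.pos_spec.2.1
    exact ⟨mk a.block ((a.pos + b.pos) / 2) ⟨by linarith, by linarith, Or.inr ha⟩,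
      lt_iff.2 (Or.inr ⟨rfl, by simp only [pos_mk]; linarith⟩),
      lt_iff.2 (Or.inr ⟨hb, by simp only [pos_mk]; linarith⟩)⟩

/-- A point of a dense block that belongs to a finite union of intervals is not isolated in it
from the right. -/
theorem exists_gt_mem {a : Expansion V} (ha : a.block ∈ V) (g : List (Expansion V))
    (hg : a ∈ oddSet g) : ∃ b, a < b ∧ b ∈ oddSet g := by
  have key : ∃ b, a < b ∧ ∀ c ∈ g, c ≤ b → c ≤ a := by
    clear hg
    induction g with
    | nil => exact ⟨Expansion.min V (a.block + 1), lt_iff.2 (Or.inl (by simp)), by simp⟩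
    | cons c g ih =>
      obtain ⟨b, hab, hb⟩ := ih
      rcases le_or_gt c a with hc | hc
      · exact ⟨b, hab, by simpa using ⟨fun _ => hc, hb⟩⟩
      · obtain ⟨d, had, hd⟩ := exists_between ha (lt_min hab hc)
        refine ⟨d, had, fun x hx hxd => ?_⟩
        rcases List.mem_cons.1 hx with rfl | hx
        · exact absurd (hxd.trans_lt hd) (not_lt.2 (min_le_right _ _))
        · exact hb x hx (hxd.trans (hd.le.trans (min_le_left _ _)))
  obtain ⟨b, hab, hb⟩ := key
  refine ⟨b, hab, ?_⟩
  have : g.countP (fun c => decide (c ≤ b)) = g.countP (fun c => decide (c ≤ a)) :=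
    List.countP_congr fun c hc => by simpa using ⟨hb c hc, fun h => h.trans hab.le⟩
  simpa only [oddSet, Set.mem_ofPred_eq, this] using hg

/-- The atoms of the interval algebra are the blocks that consist of a single point. -/
theorem isAtom_iff {T : intalg (Expansion V)} : IsAtom T ↔ ∃ x, x ∉ V ∧ T = blockSet V x := by
  constructor
  · intro hT
    obtain ⟨l, hl⟩ : ∃ l, endpoints T = l := ⟨_, rfl⟩
    have hTl := toIntalg_endpoints T
    have hsort := endpoints_pairwise T
    have hU := unionIco_endpoints T
    rw [hl] at hTl hsort hU
    obtain ⟨a, m, rfl⟩ := List.exists_cons_of_ne_nil (l := l) (by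
      rintro rfl
      exact hT.1 (hTl.symm.trans toIntalg_nil))
    have hleast := isLeast_unionIco a m hsort
    rw [hU] at hleast
    -- the atom lies below or is disjoint from `[b, ∞)` for each `b`, so it is a singleton
    have huniq : ∀ b ∈ T.1, b = a := by
      intro b hb
      by_contra hne
      have hab : a < b := lt_of_le_of_ne (hleast.2 hb) (Ne.symm hne)
      have hlt : T ⊓ toIntalg [b] < T := by
        refine lt_of_le_of_ne inf_le_left fun h => ?_
        have h1 : a ∈ (T ⊓ toIntalg [b]).1 := by
          rw [h]
          exact hleast.1
        have h2 : a ∈ oddSet [b] := h1.2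
        simp [hab.not_ge] at h2
      have h3 : b ∈ (T ⊓ toIntalg [b]).1 := ⟨hb, show b ∈ oddSet [b] by simp⟩
      rw [hT.2 _ hlt] at h3
      exact h3
    have haV : a.block ∉ V := by
      intro haV
      obtain ⟨b, hab, hb⟩ := exists_gt_mem haV (endpoints T) (by
        rw [oddSet_endpoints]
        exact hleast.1)
      rw [oddSet_endpoints] at hb
      exact hab.ne' (huniq b hb)
    have hsingle : ∀ z : Expansion V, z.block = a.block → z = a := fun z hz =>
      Expansion.ext hz (by
        rw [a.pos_spec.2.2.resolve_right haV, z.pos_spec.2.2.resolve_right (hz ▸ haV)])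
    refine ⟨a.block, haV, Subtype.ext (Set.ext fun z => ?_)⟩
    rw [mem_blockSet]
    exact ⟨fun hz => by rw [huniq z hz], fun hz => hsingle z hz ▸ hleast.1⟩
  · rintro ⟨x, hx, rfl⟩
    have hsingle : ∀ z : Expansion V, z.block = x → z = Expansion.min V x := fun z hz =>
      Expansion.ext hz (z.pos_spec.2.2.resolve_right (hz ▸ hx))
    refine ⟨fun h => ?_, fun S hS => ?_⟩
    · have h1 : Expansion.min V x ∈ (blockSet V x).1 := mem_blockSet.2 rfl
      rw [h] at h1
      exact h1
    · refine Subtype.ext (Set.eq_empty_of_forall_notMem fun z hz => hS.not_ge fun w hw => ?_)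
      have hz' := hsingle z (mem_blockSet.1 (hS.le hz))
      have hw' := hsingle w (mem_blockSet.1 hw)
      rw [hw', ← hz']
      exact hz

theorem isAtom_blockSet_iff {x : ℕ} : IsAtom (blockSet V x) ↔ x ∉ V := by
  rw [isAtom_iff]
  constructor
  · rintro ⟨y, hy, h⟩
    rwa [blockSet_injective h]
  · exact fun h => ⟨x, h, rfl⟩

end Expansion

namespace Presentation

variable {V : ℕ → Set ℕ} (A : Presentation V)

open Expansion

theorem code_blockSet (e x : ℕ) :
    (A.algebra e).code (blockSet (V e) x) = Encodable.encode [2 * x, 2 * (x + 1)] := by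
  have h : [Expansion.min (V e) x, Expansion.min (V e) (x + 1)].Pairwise (· < ·) := by
    simp [lt_iff]
  have h1 : endpoints (blockSet (V e) x) = _ := endpoints_toIntalg_of_pairwise h
  refine congrArg Encodable.encode (?_ : List.map _ (endpoints (blockSet (V e) x)) = _)
  rw [h1]
  simp [A.name_min]

/-- A one-one reduction maps `x` to `y` if the block of `x` is mapped to the block of an odd `y`,
and to `2x` otherwise. In the second case `x ∈ V e`, as the block of a non-member is an atom, and
so is mapped to the block of a non-member, which is odd. -/
theorem oneOneReducible_of_compIso (heven : ∀ e x, Even x → x ∈ V e) {e i : ℕ}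
    (h : (A.algebra e).CompIso (A.algebra i)) :
    OneOneReducible (fun x => x ∈ V e) (fun x => x ∈ V i) := by
  obtain ⟨f, p, hp, hf⟩ := h
  -- `F x` is the code of the image of the block of `x`, and `y x` is the only candidate for a
  -- number whose block has this code
  let F : ℕ → ℕ := fun x => (A.algebra i).code (f (blockSet (V e) x))
  have hF : Computable F := by
    have h1 : Computable fun x : ℕ => Encodable.encode [2 * x, 2 * (x + 1)] := by fun_prop
    refine ((Partrec.nat_iff.2 hp).comp h1).of_eq fun x => ?_
    rw [← A.code_blockSet e x]
    exact hf _
  let y : ℕ → ℕ := fun x => ((Denumerable.ofNat (List ℕ) (F x))[0]?.getD 0) / 2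
  let G : ℕ → Prop := fun x => F x = Encodable.encode [2 * y x, 2 * (y x + 1)] ∧ y x % 2 = 1
  have hy : Computable y := by fun_prop
  have hG : ComputablePred G := by fun_prop
  have hGF : ∀ x, G x → f (blockSet (V e) x) = blockSet (V i) (y x) := fun x hx =>
    (A.algebra i).code_injective (hx.1.trans (A.code_blockSet i (y x)).symm)
  have hatom : ∀ x, IsAtom (f (blockSet (V e) x)) ↔ x ∉ V e := fun x =>
    (OrderIso.isAtom_iff f _).trans isAtom_blockSet_iff
  classical
  refine ⟨fun x => if G x then y x else 2 * x, by fun_prop, fun x z hxz => ?_, fun x => ?_⟩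
  · dsimp only at hxz
    split_ifs at hxz with hx hz hz
    · have h1 := hGF x hx
      rw [hxz, ← hGF z hz] at h1
      exact blockSet_injective (f.injective h1)
    · have := hx.2
      omega
    · have := hz.2
      omega
    · omega
  · dsimp only
    split_ifs with hx
    · have h1 := hatom x
      rw [hGF x hx] at h1
      exact not_iff_not.1 (h1.symm.trans isAtom_blockSet_iff)
    · refine iff_of_true (by_contra fun hxV => hx ?_) (heven i _ (even_two_mul x))
      obtain ⟨z, hz, hfz⟩ := isAtom_iff.1 ((hatom x).2 hxV)
      have h1 : F x = Encodable.encode [2 * z, 2 * (z + 1)] :=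
        (congrArg (A.algebra i).code hfz).trans (A.code_blockSet i z)
      have h2 : y x = z := by simp [y, h1]
      have h3 : ¬ Even z := fun h => hz (heven i z h)
      refine ⟨by rw [h2, h1], ?_⟩
      rw [h2]
      exact Nat.odd_iff.1 (Nat.not_even_iff_odd.1 h3)

theorem oneOneEquiv_iff_compIso (heven : ∀ e x, Even x → x ∈ V e) (e i : ℕ) :
    OneOneEquiv (fun x => x ∈ V e) (fun x => x ∈ V i) ↔
      (A.algebra e).CompIso (A.algebra i) := by
  obtain ⟨g, -, -, hg⟩ := A.exists_index
  exact ⟨A.compIso_of_oneOneEquiv, fun h => ⟨A.oneOneReducible_of_compIso heven h,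
    A.oneOneReducible_of_compIso heven (h.symm (hg e))⟩⟩

end Presentation

/-! ### Completeness -/

theorem mainTheorem6 :
    (∀ V : ℕ → Set ℕ,
      REPred (fun p : ℕ × ℕ => p.2 ∈ V p.1) →
      (∀ e x, Even x → x ∈ V e) →
      ∃ (c : (e : ℕ) → Expansion (V e) ≃ ℕ) (g : ℕ → ℕ),
        ComputablePred (fun p : ℕ × ℕ × ℕ => (c p.1).symm p.2.1 ≤ (c p.1).symm p.2.2) ∧
        (∀ e x, c e (Expansion.min (V e) x) = 2 * x) ∧
        Computable g ∧ Function.Injective g ∧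
        (∀ e, (intalgBA (Expansion (V e)) (c e).toEmbedding).HasIndex (g e)) ∧
        (∀ e i, OneOneEquiv (fun x => x ∈ V e) (fun x => x ∈ V i) ↔
          (intalgBA (Expansion (V e)) (c e).toEmbedding).CompIso
            (intalgBA (Expansion (V i)) (c i).toEmbedding)) ∧
        (∀ e i, OneOneEquiv (fun x => x ∈ V e) (fun x => x ∈ V i) ↔ compIsoBA (g e) (g i))) ∧
    IsSigmaThreeEqComplete computableBAIndices compIsoBA := by
  refine ⟨fun V hV heven => ?_, ?_⟩
  · obtain ⟨A⟩ := Presentation.nonempty hV heven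
    obtain ⟨g, hg, hinj, hindex⟩ := A.exists_index
    exact ⟨A.name, g, A.computablePred_le, A.name_min, hg, hinj, hindex,
      A.oneOneEquiv_iff_compIso heven, fun e i =>
        (A.oneOneEquiv_iff_compIso heven e i).trans (compIsoBA_iff (hindex e) (hindex i)).symm⟩
  · constructor
    · rintro e i ⟨A, B, hA, -, -⟩
      exact ⟨A, hA⟩
    · rintro e i ⟨A, B, -, hB, -⟩
      exact ⟨B, hB⟩
    · rintro e ⟨A, hA⟩
      exact ⟨A, A, hA, hA, hA.compIso hA⟩
    · rintro e i ⟨A, B, hA, hB, h⟩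
      exact ⟨B, A, hB, hA, h.symm hA⟩
    · rintro e i j ⟨A, B, hA, hB, h⟩ ⟨B', C, hB', hC, h'⟩
      exact ⟨A, C, hA, hC, h.trans ((hB.compIso hB').trans h')⟩
    · exact isSigmaThree_compIsoBA
    · intro S hS hSigma
      obtain ⟨V, hV, heven, hVS⟩ := hSigma.exists_oneOneEquiv hS
      obtain ⟨A⟩ := Presentation.nonempty hV heven
      obtain ⟨g, hg, hinj, hindex⟩ := A.exists_index
      exact ⟨g, hg, hinj, fun x => ⟨_, hindex x⟩, fun x y => (hVS x y).trans
        ((A.oneOneEquiv_iff_compIso heven x y).trans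
          (compIsoBA_iff (hindex x) (hindex y)).symm)⟩
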